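/- Let $0<\alpha<1$, $T>0$, and let $\Omega\subset\mathbb R^d$ be a bounded domain (Lipschitz, with $d\in\{1,2,3\}$, in the paper; any bounded open set in any dimension is allowed). Let $$\mathcal L v=\sum_{k=1}^d\bigl\{-a_k(x)\,\partial_{x_k}^2v+b_k(x)\,\partial_{x_k}v\bigr\}+c(x)\,v$$ with $a_k,b_k,c\in C(\bar\Omega)$, $a_k>0$ and $c\ge\lambda$ in $\bar\Omega$, for some constant $\lambda\ge0$. For $t>0$ let $D_t^\alpha$ be the Caputo derivative $$D_t^\alpha v(t)=\frac1{\Gamma(1-\alpha)}\int_0^t(t-s)^{-\alpha}\,\partial_sv(s)\,ds ,$$ understood, for functions that are less regular or discontinuous at $t=0$, in the equivalent form $$\Gamma(1-\alpha)\,D_t^\alpha v(t)=t^{-\alpha}\{v(t)-v(0)\}+\alpha\int_0^t(t-s)^{-\alpha-1}\{v(t)-v(s)\}\,ds .$$ Let $u$ solve $D_t^\alpha u+\mathcal Lu=f$ in $\Omega\times(0,T]$, $u(\cdot,0)=u_0$ in $\Omega$, $u=0$ on $\partial\Omega$ for $0<t\le T$, and let $u_h$ be an approximation with $u_h(\cdot,0)=u_0$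 in $\Omega$ and $u_h=0$ on $\partial\Omega$ for $0<t\le T$. Suppose that $u$ and $u_h$ are in $C(\bar\Omega\times[0,t])\cap W^{1,\infty}(\epsilon,t;L_\infty(\Omega))$ for all $0<\epsilon<t\le T$, and in $C^2(\Omega)$ for each $t\in(0,T]$. Set $e=u_h-u$, $R_h(\cdot,t)=(D_t^\alpha+\mathcal L)u_h(\cdot,t)-f(\cdot,t)$, and write $\|\cdot\|=\|\cdot\|_{L_\infty(\Omega)}\in[0,\infty]$. Then the following holds. (i) For $0<t\le T$, $$\|e(\cdot,t)\|\le\int_0^t(t-s)^{\alpha-1}E_{\alpha,\alpha}\bigl(-\lambda(t-s)^\alpha\bigr)\,\|R_h(\cdot,s)\|\,ds,\qquad E_{\alpha,\beta}(z)=\sum_{k=0}^\infty\frac{z^k}{\Gamma(\alpha k+\beta)} .$$ (ii) Let $\mathcal E\ge0$ be a function on $[0,T]$ that is continuous on $(0,T]$ and for which the integral that defines $D_t^\alpha\mathcal E(t)$ converges absolutely for each $t\in(0,T]$. If $\|R_h(\cdot,t)\|\le(D_t^\alpha+\lambda)\mathcal E(t)$ for all $0<t\le T$, then $\|e(\cdot,t)\|\le\mathcal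 E(t)$ for all $0\le t\le T$. (iii) For $0<t\le T$ and every $\tau>0$, $$\|e(\cdot,t)\|\le\sup_{0<s\le t}\frac{\|R_h(\cdot,s)\|}{\mathcal R_0(s)},\qquad \|e(\cdot,t)\|\le\mathcal E_1(t)\sup_{0<s\le t}\frac{\|R_h(\cdot,s)\|}{\mathcal R_1(s)}\le t^{\alpha-1}\sup_{0<s\le t}\frac{\|R_h(\cdot,s)\|}{\mathcal R_1(s)},$$ where $\mathcal R_0(t)=\Gamma(1-\alpha)^{-1}t^{-\alpha}+\lambda$, $\mathcal R_1(t)=\Gamma(1-\alpha)^{-1}t^{-1}\rho(\tau/t)+\lambda\,\mathcal E_1(t)$, $\mathcal E_1(t)=\max\{\tau,t\}^{\alpha-1}$, and $\rho(s)=s^{-\beta}\bigl[1-(\max\{0,1-s\})^\beta\bigr]\ge s^{-\beta}\min\{\beta s,1\}$ for $s>0$, with $\beta=1-\alpha$. -/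

import Mathlib

open Set Filter Topology MeasureTheory
open scoped ENNReal NNReal ContDiff

noncomputable section

namespace TimeFrac

/-! ### The Caputo derivative -/

/-- The integrand `(t - s)^{-α-1} (v t - v s)` of the regularized form of the Caputo derivative. -/
def caputoIntegrand (α : ℝ) (v : ℝ → ℝ) (t s : ℝ) : ℝ :=
  (t - s) ^ (-α - 1) * (v t - v s)

/-- The Caputo derivative of order `α ∈ (0,1)` at time `t > 0`, in the form
`Γ(1-α)⁻¹ (t^{-α} (v t - v 0) + α ∫₀ᵗ (t-s)^{-α-1} (v t - v s) ds)`,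
which makes sense for functions that are merely Lipschitz away from `0`, and for functions that
jump at `0` (a jump contributes the Dirac mass of `∂ₜ v` at `0`).
For `v` continuous at `0` and Lipschitz on every `[ε, t]` it is
`J_t^{1-α} (∂ₜ v) = Γ(1-α)⁻¹ ∫₀ᵗ (t-s)^{-α} ∂ₛ v s ds`, the integral being improper at `0` if
`∂ₛ v` is not integrable there: see `caputo_tendsto` and `caputo_eq_integral_deriv`. -/
def caputo (α : ℝ) (v : ℝ → ℝ) (t : ℝ) : ℝ :=
  (Real.Gamma (1 - α))⁻¹ *
    (t ^ (-α) * (v t - v 0) + α * ∫ s in Ioo 0 t, caputoIntegrand α v t s)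

/-- The integral that defines `caputo α v t` converges. -/
def HasCaputo (α : ℝ) (v : ℝ → ℝ) (t : ℝ) : Prop :=
  IntegrableOn (caputoIntegrand α v t) (Ioo 0 t)

/-! ### The inverse of `D_t^α + λ` -/

/-- The two-parameter Mittag-Leffler function `E_{α,β}(z) = ∑ₖ zᵏ / Γ(αk+β)`. -/
def mittagLeffler (α β z : ℝ) : ℝ :=
  ∑' k : ℕ, (Real.Gamma (α * k + β))⁻¹ * z ^ k

/-- `(D_t^α + λ)⁻¹ v (t) = ∫₀ᵗ (t-s)^{α-1} E_{α,α}(-λ (t-s)^α) v(s) ds` for `v ≥ 0` with values in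
`[0, ∞]` (the kernel is positive). -/
def invCaputoAdd (α lam : ℝ) (v : ℝ → ℝ≥0∞) (t : ℝ) : ℝ≥0∞ :=
  ∫⁻ s in Ioo 0 t,
    ENNReal.ofReal ((t - s) ^ (α - 1) * mittagLeffler α α (-lam * (t - s) ^ α)) * v s

/-! ### Residual barriers -/

/-- `ρ(s) = s^{-β} [1 - ((1-s)⁺)^β]` with `β = 1 - α`. -/
def rho (α s : ℝ) : ℝ :=
  s ^ (-(1 - α)) * (1 - (max 0 (1 - s)) ^ (1 - α))

/-- `𝓡₀(t) = Γ(1-α)⁻¹ t^{-α} + λ`. -/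
def barrierR₀ (α lam t : ℝ) : ℝ :=
  (Real.Gamma (1 - α))⁻¹ * t ^ (-α) + lam

/-- `𝓔₁(t) = max{τ, t}^{α-1}` (for `t > 0`). -/
def barrierE₁ (α τ t : ℝ) : ℝ :=
  (max τ t) ^ (α - 1)

/-- `𝓡₁(t) = Γ(1-α)⁻¹ t⁻¹ ρ(τ/t) + λ 𝓔₁(t)`. -/
def barrierR₁ (α lam τ t : ℝ) : ℝ :=
  (Real.Gamma (1 - α))⁻¹ * t⁻¹ * rho α (τ / t) + lam * barrierE₁ α τ t

/-! ### The spatial operator, norms and function spaces -/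

/-- The partial derivative `∂_{x_k} v (x)`. -/
def partialDeriv {d : ℕ} (k : Fin d) (v : EuclideanSpace ℝ (Fin d) → ℝ)
    (x : EuclideanSpace ℝ (Fin d)) : ℝ :=
  lineDeriv ℝ v x (EuclideanSpace.single k 1)

/-- `𝓛 v = ∑ₖ (-aₖ ∂²_{x_k} v + bₖ ∂_{x_k} v) + c v`. -/
def spatialOp {d : ℕ} (a b : Fin d → EuclideanSpace ℝ (Fin d) → ℝ)
    (c : EuclideanSpace ℝ (Fin d) → ℝ) (v : EuclideanSpace ℝ (Fin d) → ℝ)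
    (x : EuclideanSpace ℝ (Fin d)) : ℝ :=
  ∑ k, (-a k x * partialDeriv k (partialDeriv k v) x + b k x * partialDeriv k v x) + c x * v x

/-- The `L_∞(Ω)` norm (with value `∞` if `v` is not essentially bounded). -/
def normLinf {d : ℕ} (Ω : Set (EuclideanSpace ℝ (Fin d)))
    (v : EuclideanSpace ℝ (Fin d) → ℝ) : ℝ≥0∞ :=
  eLpNorm v ∞ (volume.restrict Ω)

/-- `v ∈ W^{1,∞}(t₁, t₂; L_∞(Ω))`: as a function of time with values in `L_∞(Ω)`, `v` is
(Bochner) measurable and essentially bounded, and so is its weak derivative `G`. -/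
def MemW1Inf {d : ℕ} (Ω : Set (EuclideanSpace ℝ (Fin d))) (t₁ t₂ : ℝ)
    (v : EuclideanSpace ℝ (Fin d) → ℝ → ℝ) : Prop :=
  ∃ V G : ℝ → Lp ℝ ∞ (volume.restrict Ω),
    (∀ᵐ t ∂volume.restrict (Ioo t₁ t₂), V t =ᵐ[volume.restrict Ω] fun x => v x t) ∧
    MemLp V ∞ (volume.restrict (Ioo t₁ t₂)) ∧
    MemLp G ∞ (volume.restrict (Ioo t₁ t₂)) ∧
    ∀ φ : ℝ → ℝ, ContDiff ℝ ∞ φ → HasCompactSupport φ → tsupport φ ⊆ Ioo t₁ t₂ →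
      ∫ t in Ioo t₁ t₂, deriv φ t • V t = -∫ t in Ioo t₁ t₂, φ t • G t

/-- The regularity class: `v ∈ C(Ω̄ × [0,t]) ∩ W^{1,∞}(ε, t; L_∞(Ω))` for all `0 < ε < t ≤ T`, and
`v(·,t) ∈ C²(Ω)` for all `0 < t ≤ T`. -/
structure Regular {d : ℕ} (Ω : Set (EuclideanSpace ℝ (Fin d))) (T : ℝ)
    (v : EuclideanSpace ℝ (Fin d) → ℝ → ℝ) : Prop where
  continuousOn : ContinuousOn (fun p : EuclideanSpace ℝ (Fin d) × ℝ => v p.1 p.2)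
    (closure Ω ×ˢ Icc 0 T)
  memW1Inf : ∀ ε t : ℝ, 0 < ε → ε < t → t ≤ T → MemW1Inf Ω ε t v
  contDiffOn : ∀ t ∈ Ioc 0 T, ContDiffOn ℝ 2 (fun x => v x t) Ω

/-- `R(x,t) = (D_t^α + 𝓛) w (x,t) - f(x,t)`. -/
def residual {d : ℕ} (α : ℝ) (a b : Fin d → EuclideanSpace ℝ (Fin d) → ℝ)
    (c : EuclideanSpace ℝ (Fin d) → ℝ) (f w : EuclideanSpace ℝ (Fin d) → ℝ → ℝ)
    (x : EuclideanSpace ℝ (Fin d)) (t : ℝ) : ℝ :=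
  caputo α (w x) t + spatialOp a b c (fun y => w y t) x - f x t

/-- `w` satisfies the initial condition `w(·,0) = u₀` in `Ω` and the boundary condition `w = 0` on
`∂Ω` for `0 < t ≤ T`. -/
structure HasData {d : ℕ} (Ω : Set (EuclideanSpace ℝ (Fin d))) (T : ℝ)
    (u₀ : EuclideanSpace ℝ (Fin d) → ℝ) (w : EuclideanSpace ℝ (Fin d) → ℝ → ℝ) : Prop where
  initial : ∀ x ∈ Ω, w x 0 = u₀ x
  boundary : ∀ x ∈ frontier Ω, ∀ t ∈ Ioc 0 T, w x t = 0

/-! ### The Caputo derivative as `J_t^{1-α} ∂ₜ` -/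

/-- For `v` continuous at `0` and Lipschitz on every `[ε, t]`, `caputo α v t` is the improper integral
`Γ(1-α)⁻¹ ∫₀ᵗ (t-s)^{-α} ∂ₛ v s ds`. -/
theorem caputo_tendsto {α t : ℝ} (hα : α ∈ Ioo (0 : ℝ) 1) (ht : 0 < t) {v : ℝ → ℝ}
    (hv0 : Tendsto v (𝓝[>] 0) (𝓝 (v 0)))
    (hv : ∀ ε ∈ Ioo 0 t, ∃ K : ℝ≥0, LipschitzOnWith K v (Icc ε t)) :
    Tendsto (fun ε => (Real.Gamma (1 - α))⁻¹ * ∫ s in Ioo ε t, (t - s) ^ (-α) * deriv v s)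
      (𝓝[>] 0) (𝓝 (caputo α v t)) := by
  obtain ⟨hα0, hα1⟩ := hα
  -- continuity of `v` away from zero
  have hvc : ContinuousOn v (Ioc 0 t) := by
    intro x hx
    obtain ⟨K, hK⟩ := hv (x / 2) ⟨by linarith [hx.1], by linarith [hx.1, hx.2]⟩
    refine (hK.continuousOn x ⟨by linarith [hx.1], hx.2⟩).mono_of_mem_nhdsWithin ?_
    have : Ioi (x / 2) ∩ Ioc 0 t ∈ 𝓝[Ioc 0 t] x :=
      inter_mem (mem_nhdsWithin_of_mem_nhds (Ioi_mem_nhds (by linarith [hx.1])))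
        self_mem_nhdsWithin
    exact mem_of_superset this fun y hy => ⟨le_of_lt hy.1, hy.2.2⟩
  have hpw : ∀ p : ℝ, ContinuousOn (fun s : ℝ => (t - s) ^ p) (Iio t) := fun p =>
    ContinuousOn.rpow_const (by fun_prop) fun s hs => Or.inl (sub_pos.2 hs).ne'
  have hIc : ContinuousOn (caputoIntegrand α v t) (Ioo 0 t) :=
    ((hpw _).mono fun s hs => hs.2).mul
      (continuousOn_const.sub (hvc.mono Ioo_subset_Ioc_self))
  have hpint : ∀ p : ℝ, -1 < p → ∀ ε : ℝ,
      IntervalIntegrable (fun s : ℝ => (t - s) ^ p) volume ε t := by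
    intro p hp ε
    have := (intervalIntegral.intervalIntegrable_rpow' (a := t - ε) (b := 0) hp).comp_sub_left t
    simpa using this
  -- Lipschitz bound of the integrand
  have hIb : ∀ ε ∈ Ioo 0 t, ∃ K : ℝ≥0, LipschitzOnWith K v (Icc ε t) ∧
      ∀ s ∈ Ico ε t, |caputoIntegrand α v t s| ≤ K * (t - s) ^ (-α) := by
    intro ε hε
    obtain ⟨K, hK⟩ := hv ε hε
    refine ⟨K, hK, fun s hs => ?_⟩
    have hts : 0 < t - s := sub_pos.2 hs.2
    have h1 := hK.dist_le_mul t ⟨hε.2.le, le_rfl⟩ s ⟨hs.1, hs.2.le⟩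
    rw [Real.dist_eq, Real.dist_eq, abs_of_pos hts] at h1
    rw [caputoIntegrand, abs_mul, abs_of_pos (Real.rpow_pos_of_pos hts _)]
    calc (t - s) ^ (-α - 1) * |v t - v s| ≤ (t - s) ^ (-α - 1) * (K * (t - s)) := by gcongr
      _ = K * ((t - s) ^ (-α - 1) * (t - s)) := by ring
      _ = K * (t - s) ^ (-α) := by
        rw [← Real.rpow_add_one hts.ne']; congr 2; ring
  -- the integrand is integrable up to `t`
  have hIint : ∀ ε ∈ Ioo 0 t, IntegrableOn (caputoIntegrand α v t) (Ioo ε t) := by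
    intro ε hε
    obtain ⟨K, -, hK⟩ := hIb ε hε
    have hg : IntegrableOn (fun s : ℝ => (K : ℝ) * (t - s) ^ (-α)) (Ioo ε t) :=
      (((intervalIntegrable_iff_integrableOn_Ioo_of_le hε.2.le).1
        (hpint (-α) (by linarith) ε))).const_mul _
    refine Integrable.mono' hg
      ((hIc.mono (Ioo_subset_Ioo_left hε.1.le)).aestronglyMeasurable measurableSet_Ioo) ?_
    refine (ae_restrict_iff' measurableSet_Ioo).2 (Eventually.of_forall fun s hs => ?_)
    exact hK s ⟨hs.1.le, hs.2⟩
  -- and near zero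
  have hIint0 : IntegrableOn (caputoIntegrand α v t) (Ioo 0 t) := by
    have hb : ∀ᶠ s in 𝓝[>] (0 : ℝ), |v s| ≤ |v 0| + 1 :=
      (hv0.abs).eventually_le_const (by linarith)
    obtain ⟨δ, hδ0, hδ⟩ := mem_nhdsGT_iff_exists_Ioo_subset.1 hb
    have hδ0 : 0 < δ := hδ0
    set η := min δ (t / 2) with hη
    have hη0 : 0 < η := lt_min hδ0 (by linarith)
    have hηt : η ≤ t / 2 := min_le_right _ _
    have hsub : Ioo 0 t ⊆ Ioc 0 (η / 2) ∪ Ioo (η / 2) t := fun s hs => by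
      rcases le_or_gt s (η / 2) with h | h
      · exact Or.inl ⟨hs.1, h⟩
      · exact Or.inr ⟨h, hs.2⟩
    refine IntegrableOn.mono_set (IntegrableOn.union ?_
      (hIint (η / 2) ⟨by linarith, by linarith⟩)) hsub
    refine Integrable.mono'
      (integrableOn_const (C := (t / 2) ^ (-α - 1) * (|v t| + (|v 0| + 1)))
        measure_Ioc_lt_top.ne)
      ((hIc.mono fun s hs => ⟨hs.1, by linarith [hs.2]⟩).aestronglyMeasurable
        measurableSet_Ioc) ?_
    refine (ae_restrict_iff' measurableSet_Ioc).2 (Eventually.of_forall fun s hs => ?_)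
    have hs1 : |v s| ≤ |v 0| + 1 :=
      hδ ⟨hs.1, by linarith [hs.2, min_le_left δ (t / 2)]⟩
    have hts : t / 2 ≤ t - s := by linarith [hs.2]
    rw [Real.norm_eq_abs, caputoIntegrand, abs_mul,
      abs_of_pos (Real.rpow_pos_of_pos (by linarith) _)]
    have h2 : (t - s) ^ (-α - 1) ≤ (t / 2) ^ (-α - 1) :=
      Real.rpow_le_rpow_of_nonpos (by linarith) hts (by linarith)
    have h3 : |v t - v s| ≤ |v t| + (|v 0| + 1) := (abs_sub _ _).trans (by linarith)
    gcongr
  -- integration by parts on `[ε, t]`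
  have key : ∀ ε ∈ Ioo 0 t, ∫ s in Ioo ε t, (t - s) ^ (-α) * deriv v s =
      (t - ε) ^ (-α) * (v t - v ε) + α * ∫ s in Ioo ε t, caputoIntegrand α v t s := by
    intro ε hε
    obtain ⟨K, hL, hK⟩ := hIb ε hε
    have hder : ∀ s ∈ Ioo ε t, |deriv v s| ≤ K := fun s hs => by
      have := norm_deriv_le_of_lipschitzOn (Icc_mem_nhds hs.1 hs.2) hL
      simpa using this
    have hfint : IntegrableOn (fun s => (t - s) ^ (-α) * deriv v s) (Ioo ε t) := by
      have hg : IntegrableOn (fun s : ℝ => (K : ℝ) * (t - s) ^ (-α)) (Ioo ε t) :=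
        (((intervalIntegrable_iff_integrableOn_Ioo_of_le hε.2.le).1
          (hpint (-α) (by linarith) ε))).const_mul _
      refine Integrable.mono' hg ((((hpw _).mono fun s hs => hs.2).aestronglyMeasurable
        measurableSet_Ioo).mul (measurable_deriv v).aestronglyMeasurable) ?_
      refine (ae_restrict_iff' measurableSet_Ioo).2 (Eventually.of_forall fun s hs => ?_)
      have hts : 0 < t - s := sub_pos.2 hs.2
      rw [Real.norm_eq_abs, abs_mul, abs_of_pos (Real.rpow_pos_of_pos hts _), mul_comm]
      gcongr
      exact hder s hs
    have hparts : ∀ η ∈ Ioo ε t, ∫ s in ε..η, (t - s) ^ (-α) * deriv v s =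
        (t - ε) ^ (-α) * (v t - v ε) - (t - η) ^ (-α) * (v t - v η)
          + α * ∫ s in ε..η, caputoIntegrand α v t s := by
      intro η hη
      have hu : uIcc ε η = Icc ε η := uIcc_of_le hη.1.le
      have hF : AbsolutelyContinuousOnInterval (fun s : ℝ => (t - s) ^ (-α)) ε η := by
        apply ContDiffOn.absolutelyContinuousOnInterval
        rw [hu]
        refine ContDiffOn.rpow_const_of_ne (by fun_prop) fun s hs => ?_
        linarith [hs.2, hη.2]
      have hG : AbsolutelyContinuousOnInterval (fun s : ℝ => v s - v t) ε η := by
        apply LipschitzOnWith.absolutelyContinuousOnInterval (K := K)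
        rw [hu]
        refine LipschitzOnWith.of_dist_le_mul fun x hx y hy => ?_
        rw [dist_sub_right]
        exact hL.dist_le_mul x ⟨hx.1, hx.2.trans hη.2.le⟩ y ⟨hy.1, hy.2.trans hη.2.le⟩
      have h := hF.integral_mul_deriv_eq_deriv_mul hG
      have h1 : ∀ s, deriv (fun s : ℝ => v s - v t) s = deriv v s := fun s => deriv_sub_const _
      simp only [h1] at h
      rw [h, ← intervalIntegral.integral_const_mul]
      have h2 : ∫ s in ε..η, deriv (fun s : ℝ => (t - s) ^ (-α)) s * (v s - v t) =
          ∫ s in ε..η, -(α * caputoIntegrand α v t s) := by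
        refine intervalIntegral.integral_congr fun s hs => ?_
        rw [hu] at hs
        have hts : 0 < t - s := by linarith [hs.2, hη.2]
        have hd : HasDerivAt (fun s : ℝ => (t - s) ^ (-α)) (-1 * (-α) * (t - s) ^ (-α - 1)) s :=
          ((hasDerivAt_id s).const_sub t).rpow_const (Or.inl hts.ne')
        simp only [hd.deriv, caputoIntegrand]
        ring
      rw [h2, intervalIntegral.integral_neg]
      ring
    have hconv : ∀ g : ℝ → ℝ, IntegrableOn g (Ioo ε t) →
        Tendsto (fun η => ∫ s in ε..η, g s) (𝓝[<] t) (𝓝 (∫ s in Ioo ε t, g s)) := by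
      intro g hg
      have hgi : IntegrableOn g (Icc ε t) :=
        (integrableOn_Icc_iff_integrableOn_Ioo enorm_ne_top enorm_ne_top).2 hg
      have hc := intervalIntegral.continuousOn_primitive_interval (f := g) (μ := volume)
        (a := ε) (b := t) (by rwa [uIcc_of_le hε.2.le])
      have hc' := hc t (right_mem_uIcc)
      rw [uIcc_of_le hε.2.le] at hc'
      have hc'' := hc'.mono_left (nhdsWithin_mono t Ioo_subset_Icc_self)
      rw [nhdsWithin_Ioo_eq_nhdsLT hε.2] at hc''
      beta_reduce at hc''
      rwa [intervalIntegral.integral_of_le hε.2.le, integral_Ioc_eq_integral_Ioo] at hc''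
    have hz : Tendsto (fun η => (t - η) ^ (-α) * (v t - v η)) (𝓝[<] t) (𝓝 0) := by
      have hlim : Tendsto (fun η : ℝ => (K : ℝ) * (t - η) ^ (1 - α)) (𝓝[<] t) (𝓝 0) := by
        have hcont : Continuous (fun η : ℝ => (K : ℝ) * (t - η) ^ (1 - α)) :=
          continuous_const.mul (Continuous.rpow_const (by fun_prop)
            fun _ => Or.inr (by linarith))
        have := hcont.tendsto t
        rw [sub_self, Real.zero_rpow (by linarith), mul_zero] at this
        exact this.mono_left nhdsWithin_le_nhds
      refine squeeze_zero_norm' ?_ hlim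
      filter_upwards [Ioo_mem_nhdsLT hε.2] with η hη
      have hts : 0 < t - η := sub_pos.2 hη.2
      have h := hK η ⟨hη.1.le, hη.2⟩
      have e1 : (t - η) ^ (-α) * (v t - v η) = (t - η) * caputoIntegrand α v t η := by
        have : (t - η) ^ (-α) = (t - η) ^ (-α - 1) * (t - η) := by
          rw [← Real.rpow_add_one hts.ne']; congr 1; ring
        rw [this, caputoIntegrand]; ring
      rw [e1, Real.norm_eq_abs, abs_mul, abs_of_pos hts]
      calc (t - η) * |caputoIntegrand α v t η| ≤ (t - η) * (K * (t - η) ^ (-α)) := by gcongr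
        _ = K * ((t - η) ^ (-α) * (t - η)) := by ring
        _ = K * (t - η) ^ (1 - α) := by
          rw [← Real.rpow_add_one hts.ne']; congr 2; ring
    have hA := hconv _ hfint
    have hB : Tendsto (fun η => (t - ε) ^ (-α) * (v t - v ε) - (t - η) ^ (-α) * (v t - v η)
          + α * ∫ s in ε..η, caputoIntegrand α v t s) (𝓝[<] t)
        (𝓝 ((t - ε) ^ (-α) * (v t - v ε) - 0
          + α * ∫ s in Ioo ε t, caputoIntegrand α v t s)) :=
      (hz.const_sub _).add ((hconv _ (hIint ε hε)).const_mul α)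
    rw [sub_zero] at hB
    refine tendsto_nhds_unique hA (hB.congr' ?_)
    filter_upwards [Ioo_mem_nhdsLT hε.2] with η hη
    exact (hparts η hη).symm
  -- the limit at zero
  have hlim : Tendsto (fun ε => ∫ s in Ioo ε t, caputoIntegrand α v t s) (𝓝[>] 0)
      (𝓝 (∫ s in Ioo 0 t, caputoIntegrand α v t s)) := by
    have hgi : IntegrableOn (caputoIntegrand α v t) (Icc 0 t) :=
      (integrableOn_Icc_iff_integrableOn_Ioo enorm_ne_top enorm_ne_top).2 hIint0
    have hc := intervalIntegral.continuousOn_primitive_interval_left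
      (f := caputoIntegrand α v t) (μ := volume) (a := 0) (b := t)
      (by rwa [uIcc_of_le ht.le])
    have hc' := hc 0 left_mem_uIcc
    rw [uIcc_of_le ht.le] at hc'
    have hc'' := hc'.mono_left (nhdsWithin_mono 0 Ioo_subset_Icc_self)
    rw [nhdsWithin_Ioo_eq_nhdsGT ht] at hc''
    beta_reduce at hc''
    rw [intervalIntegral.integral_of_le ht.le, integral_Ioc_eq_integral_Ioo] at hc''
    refine hc''.congr' ?_
    filter_upwards [Ioo_mem_nhdsGT ht] with ε hε
    rw [intervalIntegral.integral_of_le hε.2.le, integral_Ioc_eq_integral_Ioo]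
  have hpw0 : Tendsto (fun ε : ℝ => (t - ε) ^ (-α)) (𝓝[>] 0) (𝓝 (t ^ (-α))) := by
    have := ((hpw (-α)).continuousAt (Iio_mem_nhds ht)).tendsto
    rw [sub_zero] at this
    exact this.mono_left nhdsWithin_le_nhds
  have hfin := (((hpw0.mul (hv0.const_sub (v t))).add (hlim.const_mul α))).const_mul
    (Real.Gamma (1 - α))⁻¹
  refine Tendsto.congr' ?_ hfin
  filter_upwards [Ioo_mem_nhdsGT ht] with ε hε
  rw [key ε hε]

/-- `caputo α v t = Γ(1-α)⁻¹ ∫₀ᵗ (t-s)^{-α} ∂ₛ v s ds`, if `v` is continuous at `0` and Lipschitz on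
every `[ε, t]`, and the integral converges. -/
theorem caputo_eq_integral_deriv {α t : ℝ} (hα : α ∈ Ioo (0 : ℝ) 1) (ht : 0 < t) {v : ℝ → ℝ}
    (hv0 : Tendsto v (𝓝[>] 0) (𝓝 (v 0)))
    (hv : ∀ ε ∈ Ioo 0 t, ∃ K : ℝ≥0, LipschitzOnWith K v (Icc ε t))
    (hint : IntegrableOn (fun s => (t - s) ^ (-α) * deriv v s) (Ioo 0 t)) :
    caputo α v t = (Real.Gamma (1 - α))⁻¹ * ∫ s in Ioo 0 t, (t - s) ^ (-α) * deriv v s := by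
  refine tendsto_nhds_unique (caputo_tendsto hα ht hv0 hv) (Tendsto.const_mul _ ?_)
  have hgi :=
    (integrableOn_Icc_iff_integrableOn_Ioo enorm_ne_top enorm_ne_top).2 hint
  have hc := intervalIntegral.continuousOn_primitive_interval_left
    (f := fun s => (t - s) ^ (-α) * deriv v s) (μ := volume) (a := 0) (b := t)
    (by rwa [uIcc_of_le ht.le])
  have hc' := hc 0 left_mem_uIcc
  rw [uIcc_of_le ht.le] at hc'
  have hc'' := hc'.mono_left (nhdsWithin_mono 0 Ioo_subset_Icc_self)
  rw [nhdsWithin_Ioo_eq_nhdsGT ht] at hc''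
  beta_reduce at hc''
  rw [intervalIntegral.integral_of_le ht.le, integral_Ioc_eq_integral_Ioo] at hc''
  refine hc''.congr' ?_
  filter_upwards [Ioo_mem_nhdsGT ht] with ε hε
  rw [intervalIntegral.integral_of_le hε.2.le, integral_Ioc_eq_integral_Ioo]

end TimeFrac

end

noncomputable section

namespace TimeFrac

/-! The proof reduces everything to a scalar inequality in time. Let m(t) be the maximum of |e(·,t)|
over the closure of Ω. If m(t) > 0, it is attained at an interior point x with some sign σ. There σ
e(·,t) has a local maximum, so 𝓛(σ e) ≥ c m ≥ λ m. Moreover σ e(x,s) ≤ m(s) for s < t with equality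
at s = t, and the regularized Caputo derivative combines the increments v(t) - v(s) with positive
weights, so D_t^α m ≤ σ D_t^α e(x,·). Hence (D_t^α + λ) m ≤ ‖R_h‖ (`exists_maxNorm_subsolution`).

For scalar functions, the Caputo derivative is negative at a negative minimum over the past, which
gives the comparison principle `nonneg_of_caputo_add_nonneg` and thus (ii). Part (iii) compares m
with multiples of barriers that jump at time 0 and whose Caputo derivatives are explicit
(`ofReal_le_mul_iSup_div`, `caputo_barrierE₁`).

For (i), Beta integrals show that the kernel k(t) = t^(α-1) E_{α,α}(-λ t^α) satisfies k * κ = 1,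
where D_t^α + λ is convolution of κ with the derivative. Associativity gives v = k * (D_t^α + λ)v
for Lipschitz v with v(0) = 0. Positivity of k is deduced from the comparison principle, since k * h
solves the equation with datum h (`resolventKernel_nonneg`). As m need not be Lipschitz at 0, the
formula is applied to the positive part of m - δ, and δ tends to 0.

The weak time derivative with values in L_∞ is turned into a Lipschitz bound at every point of Ω,
uniform in space (`MemW1Inf.exists_lipschitz`). This also makes D_t^α e continuous in x, so that its
value at the maximum point is controlled by an essential supremum. -/

/-! ### Mittag-Leffler series, Beta integrals and the resolvent identity -/

/-- On (R, 2R] the Gamma integrand is at least R^(y-1) e^(-2R). Since R is free, Γ outgrows every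
geometric sequence. -/
theorem rpow_mul_exp_le_Gamma {R y : ℝ} (hR : 0 < R) (hy : 1 ≤ y) :
    R ^ y * Real.exp (-(2 * R)) ≤ Real.Gamma y := by
  have hint := Real.GammaIntegral_convergent (s := y) (by linarith)
  rw [Real.Gamma_eq_integral (by linarith)]
  calc R ^ y * Real.exp (-(2 * R))
      = ∫ _ in Ioc R (2 * R), Real.exp (-(2 * R)) * R ^ (y - 1) := by
        rw [setIntegral_const, smul_eq_mul, Measure.real, Real.volume_Ioc,
          ENNReal.toReal_ofReal (by linarith), Real.rpow_sub_one hR.ne']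
        field_simp
        norm_num
    _ ≤ ∫ x in Ioc R (2 * R), Real.exp (-x) * x ^ (y - 1) := by
        refine setIntegral_mono_on (integrableOn_const measure_Ioc_lt_top.ne)
          (hint.mono_set fun x hx => hR.trans hx.1) measurableSet_Ioc fun x hx => ?_
        have := hx.1
        have := hx.2
        gcongr
    _ ≤ ∫ x in Ioi 0, Real.exp (-x) * x ^ (y - 1) := by
        refine setIntegral_mono_set hint ?_ (Eventually.of_forall fun x hx => hR.trans hx.1)
        refine (ae_restrict_iff' measurableSet_Ioi).2 (Eventually.of_forall fun x hx => ?_)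
        have : (0 : ℝ) < x := hx
        change 0 ≤ _
        positivity

theorem summable_mittagLeffler {α β : ℝ} (hα : 0 < α) (hβ : 0 < β) (z : ℝ) :
    Summable fun k : ℕ => (Real.Gamma (α * k + β))⁻¹ * z ^ k := by
  -- With R = x^(1/α) the lower bound on Γ(αk+β) becomes x^k R^β e^(-2R), so the terms are
  -- eventually dominated by a constant times (|z|/x)^k, and |z|/x ≤ 1/2.
  set x : ℝ := 2 * |z| + 2 with hx
  have hx0 : 0 < x := by positivity
  set R : ℝ := x ^ α⁻¹ with hRdef
  have hR : 0 < R := by positivity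
  have hRα : R ^ α = x := by rw [hRdef, ← Real.rpow_mul hx0.le, inv_mul_cancel₀ hα.ne', Real.rpow_one]
  have hgeo : Summable fun k : ℕ => (R ^ β * Real.exp (-(2 * R)))⁻¹ * (1 / 2 : ℝ) ^ k :=
    (summable_geometric_of_lt_one (by norm_num) (by norm_num)).mul_left _
  obtain ⟨N, hN⟩ := exists_nat_ge (1 / α)
  refine Summable.of_norm_bounded_eventually_nat hgeo ?_
  filter_upwards [eventually_ge_atTop N] with k hk
  have h1 : 1 ≤ α * k + β := by
    have : 1 / α ≤ k := hN.trans (by exact_mod_cast hk)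
    have : 1 ≤ α * k := by rwa [div_le_iff₀' hα] at this
    linarith
  have h2 := rpow_mul_exp_le_Gamma hR h1
  have hG : 0 < Real.Gamma (α * k + β) := Real.Gamma_pos_of_pos (by linarith)
  rw [norm_mul, norm_inv, norm_pow, Real.norm_eq_abs, Real.norm_eq_abs, abs_of_pos hG]
  rw [Real.rpow_add hR, Real.rpow_mul hR.le, hRα, Real.rpow_natCast] at h2
  calc (Real.Gamma (α * k + β))⁻¹ * |z| ^ k
      ≤ (x ^ k * R ^ β * Real.exp (-(2 * R)))⁻¹ * |z| ^ k := by gcongr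
    _ = (R ^ β * Real.exp (-(2 * R)))⁻¹ * (|z| / x) ^ k := by
        rw [div_pow]; field_simp
    _ ≤ _ := by
        refine mul_le_mul_of_nonneg_left (pow_le_pow_left₀ (by positivity) ?_ k) (by positivity)
        rw [div_le_iff₀ hx0]
        linarith [abs_nonneg z]

theorem continuous_mittagLeffler {α β : ℝ} (hα : 0 < α) (hβ : 0 < β) :
    Continuous (mittagLeffler α β) := by
  refine continuous_iff_continuousAt.2 fun z => ?_
  have hnhds : Metric.ball (0 : ℝ) (|z| + 1) ∈ 𝓝 z :=
    Metric.isOpen_ball.mem_nhds (by simp)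
  refine ContinuousOn.continuousAt ?_ hnhds
  refine continuousOn_tsum (fun k => by fun_prop) (summable_mittagLeffler hα hβ (|z| + 1)) ?_
  intro k y hy
  have hG : 0 < Real.Gamma (α * k + β) := Real.Gamma_pos_of_pos (by positivity)
  rw [norm_mul, norm_inv, norm_pow, Real.norm_eq_abs, Real.norm_eq_abs, abs_of_pos hG]
  have : |y| ≤ |z| + 1 := by simpa using (Metric.mem_ball.1 hy).le
  gcongr

theorem mittagLeffler_one_add {α z : ℝ} (hα : 0 < α) :
    mittagLeffler α 1 z = 1 + z * mittagLeffler α (α + 1) z := by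
  rw [mittagLeffler, (summable_mittagLeffler hα one_pos z).tsum_eq_zero_add, mittagLeffler,
    ← tsum_mul_left]
  congr 1
  · simp
  · refine tsum_congr fun k => ?_
    push_cast
    rw [show α * (k + 1) + 1 = α * k + (α + 1) by ring]
    ring

/-- `∫₀ˣ q^{p-1} (x-q)^{r-1} dq = x^{p+r-1} Γ(p) Γ(r) / Γ(p+r)`. -/
theorem integral_rpow_mul_rpow {p r x : ℝ} (hp : 0 < p) (hr : 0 < r) (hx : 0 < x) :
    ∫ q in Ioo 0 x, q ^ (p - 1) * (x - q) ^ (r - 1) =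
      x ^ (p + r - 1) * (Real.Gamma p * Real.Gamma r / Real.Gamma (p + r)) := by
  have h := Complex.betaIntegral_scaled (p : ℂ) (r : ℂ) hx
  rw [Complex.betaIntegral_eq_Gamma_mul_div _ _ (by simpa) (by simpa),
    intervalIntegral.integral_of_le hx.le, integral_Ioc_eq_integral_Ioo] at h
  have h2 : ∫ q in Ioo 0 x, (q : ℂ) ^ ((p : ℂ) - 1) * ((x : ℂ) - q) ^ ((r : ℂ) - 1) =
      ∫ q in Ioo 0 x, ((q ^ (p - 1) * (x - q) ^ (r - 1) : ℝ) : ℂ) := by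
    refine setIntegral_congr_fun measurableSet_Ioo fun q hq => ?_
    have h1 : 0 ≤ x - q := by linarith [hq.2]
    simp only [Complex.ofReal_mul]
    rw [Complex.ofReal_cpow hq.1.le, Complex.ofReal_cpow h1]
    push_cast
    rfl
  rw [h2, integral_complex_ofReal] at h
  rw [← Complex.ofReal_add, Complex.Gamma_ofReal, Complex.Gamma_ofReal, Complex.Gamma_ofReal,
    ← Complex.ofReal_one, ← Complex.ofReal_sub, ← Complex.ofReal_cpow hx.le] at h
  exact_mod_cast h

/-- A non-integrable function has Bochner integral 0, whereas the Beta integral is positive. -/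
theorem integrableOn_rpow_mul_rpow {p r x : ℝ} (hp : 0 < p) (hr : 0 < r) (hx : 0 < x) :
    IntegrableOn (fun q => q ^ (p - 1) * (x - q) ^ (r - 1)) (Ioo 0 x) := by
  by_contra hcon
  have h := integral_rpow_mul_rpow hp hr hx
  rw [integral_undef hcon] at h
  have := Real.Gamma_pos_of_pos hp
  have := Real.Gamma_pos_of_pos hr
  have := Real.Gamma_pos_of_pos (add_pos hp hr)
  have : 0 < x ^ (p + r - 1) * (Real.Gamma p * Real.Gamma r / Real.Gamma (p + r)) := by positivity
  linarith

/-- The kernel of the inverse of `D_t^α + λ`. -/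
def resolventKernel (α lam t : ℝ) : ℝ :=
  t ^ (α - 1) * mittagLeffler α α (-lam * t ^ α)

theorem continuousOn_resolventKernel {α : ℝ} (hα : 0 < α) (lam : ℝ) :
    ContinuousOn (resolventKernel α lam) (Ioi 0) := by
  refine ContinuousOn.mul (ContinuousOn.rpow_const continuousOn_id fun t ht =>
    Or.inl (ne_of_gt ht)) ?_
  refine (continuous_mittagLeffler hα hα).comp_continuousOn (continuousOn_const.mul ?_)
  exact ContinuousOn.rpow_const continuousOn_id fun t ht => Or.inl (ne_of_gt ht)

theorem integrableOn_rpow_sub_one {p : ℝ} (hp : 0 < p) (T : ℝ) :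
    IntegrableOn (fun t : ℝ => t ^ (p - 1)) (Ioo 0 T) := by
  rcases le_or_gt T 0 with hT | hT
  · rw [Ioo_eq_empty (by simpa using hT)]; exact integrableOn_empty
  · exact (intervalIntegrable_iff_integrableOn_Ioo_of_le hT.le).1
      (intervalIntegral.intervalIntegrable_rpow' (by linarith))

theorem integrableOn_resolventKernel {α : ℝ} (hα : 0 < α) (lam T : ℝ) :
    IntegrableOn (resolventKernel α lam) (Ioo 0 T) := by
  have hc : Continuous fun t : ℝ => mittagLeffler α α (-lam * t ^ α) :=
    (continuous_mittagLeffler hα hα).comp (continuous_const.mul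
      (Continuous.rpow_const continuous_id fun _ => Or.inr hα.le))
  obtain ⟨C, hC⟩ := isCompact_Icc.exists_bound_of_continuousOn (s := Icc 0 T) hc.continuousOn
  refine Integrable.mul_bdd (c := C) (integrableOn_rpow_sub_one hα T)
    hc.aestronglyMeasurable ?_
  exact (ae_restrict_iff' measurableSet_Ioo).2
    (Eventually.of_forall fun t ht => hC t ⟨ht.1.le, ht.2.le⟩)

/-- The fractional integral of order `β` of the kernel. -/
theorem integral_resolventKernel_mul_rpow {α β x : ℝ} (hα : 0 < α) (hβ : 0 < β) (lam : ℝ)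
    (hx : 0 < x) :
    ∫ q in Ioo 0 x, resolventKernel α lam q * ((Real.Gamma β)⁻¹ * (x - q) ^ (β - 1)) =
      x ^ (α + β - 1) * mittagLeffler α (α + β) (-lam * x ^ α) := by
  have hGβ := Real.Gamma_pos_of_pos hβ
  set F : ℕ → ℝ → ℝ := fun j q => ((Real.Gamma (α * j + α))⁻¹ * (Real.Gamma β)⁻¹ * (-lam) ^ j) *
    (q ^ ((α * j + α) - 1) * (x - q) ^ (β - 1)) with hF
  have hp : ∀ j : ℕ, 0 < α * j + α := fun j => by positivity
  have hxp : ∀ j : ℕ, x ^ (α * j + α + β - 1) = x ^ (α + β - 1) * (x ^ α) ^ j := fun j => by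
    rw [← Real.rpow_natCast, ← Real.rpow_mul hx.le, ← Real.rpow_add hx]; congr 1; ring
  have hFi : ∀ j, Integrable (F j) (volume.restrict (Ioo 0 x)) := fun j =>
    (integrableOn_rpow_mul_rpow (hp j) hβ hx).const_mul _
  -- Absolute values only replace -λ by |λ|, so the norms sum to a convergent Mittag-Leffler series
  -- and termwise integration is justified.
  have hFn : ∀ j, ∫ q in Ioo 0 x, ‖F j q‖ =
      x ^ (α + β - 1) * ((Real.Gamma (α * j + (α + β)))⁻¹ * (|lam| * x ^ α) ^ j) := by
    intro j
    have hG := Real.Gamma_pos_of_pos (hp j)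
    have : ∫ q in Ioo 0 x, ‖F j q‖ =
        ∫ q in Ioo 0 x, ((Real.Gamma (α * j + α))⁻¹ * (Real.Gamma β)⁻¹ * |lam| ^ j) *
          (q ^ ((α * j + α) - 1) * (x - q) ^ (β - 1)) := by
      refine setIntegral_congr_fun measurableSet_Ioo fun q hq => ?_
      have h1 : 0 < x - q := by linarith [hq.2]
      have h2 := hq.1
      simp only [hF, norm_mul, norm_pow, norm_inv, norm_neg, Real.norm_eq_abs]
      rw [abs_of_pos hG, abs_of_pos hGβ, abs_of_pos (Real.rpow_pos_of_pos h1 _),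
        abs_of_pos (Real.rpow_pos_of_pos h2 _)]
    rw [this, integral_const_mul, integral_rpow_mul_rpow (hp j) hβ hx, hxp, mul_pow, ← add_assoc]
    field_simp
  have hFs : ∀ j, ∫ q in Ioo 0 x, F j q =
      x ^ (α + β - 1) * ((Real.Gamma (α * j + (α + β)))⁻¹ * (-lam * x ^ α) ^ j) := by
    intro j
    have hG := Real.Gamma_pos_of_pos (hp j)
    rw [hF, integral_const_mul, integral_rpow_mul_rpow (hp j) hβ hx, hxp, mul_pow, ← add_assoc]
    field_simp
  have hsum : Summable fun j => ∫ q in Ioo 0 x, ‖F j q‖ := by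
    simp_rw [hFn]
    exact (summable_mittagLeffler hα (add_pos hα hβ) _).mul_left _
  have h := hasSum_integral_of_summable_integral_norm hFi hsum
  simp_rw [hFs] at h
  rw [mittagLeffler, ← tsum_mul_left, h.tsum_eq]
  refine setIntegral_congr_fun measurableSet_Ioo fun q hq => ?_
  simp only [resolventKernel, mittagLeffler, hF]
  rw [← tsum_mul_left, ← tsum_mul_right]
  refine tsum_congr fun j => ?_
  have : q ^ (α * j + α - 1) = q ^ (α - 1) * (q ^ α) ^ j := by
    rw [← Real.rpow_natCast, ← Real.rpow_mul hq.1.le, ← Real.rpow_add hq.1]; congr 1; ring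
  rw [this, mul_pow]
  ring

/-- The kernel of the Caputo derivative, as an operator acting on the derivative. -/
def caputoKernel (α t : ℝ) : ℝ := (Real.Gamma (1 - α))⁻¹ * t ^ (-α)

theorem integrableOn_caputoKernel {α : ℝ} (hα : α < 1) (T : ℝ) :
    IntegrableOn (caputoKernel α) (Ioo 0 T) := by
  have := (integrableOn_rpow_sub_one (p := 1 - α) (by linarith) T).const_mul
    (Real.Gamma (1 - α))⁻¹
  rwa [show 1 - α - 1 = -α by ring] at this

/-- The resolvent identity. -/
theorem integral_resolventKernel_mul_caputoKernel {α x : ℝ} (hα : α ∈ Ioo (0 : ℝ) 1) (lam : ℝ)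
    (hx : 0 < x) :
    (∫ q in Ioo 0 x, resolventKernel α lam q * caputoKernel α (x - q)) +
      lam * ∫ q in Ioo 0 x, resolventKernel α lam q = 1 := by
  -- The orders 1 - α and 1 produce E_{α,1}(z) and x^α E_{α,α+1}(z) with z = -λ x^α, which are
  -- linked by shifting the series by one index.
  have h1 := integral_resolventKernel_mul_rpow hα.1 (sub_pos.2 hα.2) lam hx
  have h2 := integral_resolventKernel_mul_rpow hα.1 one_pos lam hx
  simp only [Real.Gamma_one, inv_one, sub_self, Real.rpow_zero, mul_one] at h2
  rw [show 1 - α - 1 = -α by ring] at h1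
  simp only [caputoKernel]
  rw [h1, h2, show α + (1 - α) - 1 = 0 by ring, show α + (1 - α) = 1 by ring, Real.rpow_zero,
    show α + 1 - 1 = α by ring, mittagLeffler_one_add hα.1]
  ring

/-! ### Convergence and monotonicity of Caputo derivatives; the comparison principle -/

theorem integrableOn_sub_rpow_neg {α : ℝ} (hα : α < 1) (t : ℝ) :
    IntegrableOn (fun s : ℝ => (t - s) ^ (-α)) (Ioo 0 t) := by
  rcases le_or_gt t 0 with ht | ht
  · rw [Ioo_eq_empty (by simpa using ht)]; exact integrableOn_empty
  · have := (intervalIntegral.intervalIntegrable_rpow' (a := t) (b := 0)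
      (r := -α) (by linarith)).comp_sub_left t
    rw [sub_self, sub_zero] at this
    exact (intervalIntegrable_iff_integrableOn_Ioo_of_le ht.le).1 this

theorem abs_caputoIntegrand_le {α C t s : ℝ} {v : ℝ → ℝ} (hs : s < t)
    (h : |v t - v s| ≤ C * (t - s)) : |caputoIntegrand α v t s| ≤ C * (t - s) ^ (-α) := by
  have hts : 0 < t - s := sub_pos.2 hs
  rw [caputoIntegrand, abs_mul, abs_of_pos (Real.rpow_pos_of_pos hts _)]
  calc (t - s) ^ (-α - 1) * |v t - v s| ≤ (t - s) ^ (-α - 1) * (C * (t - s)) := by gcongr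
    _ = C * ((t - s) ^ (-α - 1) * (t - s)) := by ring
    _ = C * (t - s) ^ (-α) := by
      rw [← Real.rpow_add_one hts.ne']; congr 2; ring

theorem continuousOn_caputoIntegrand (α : ℝ) {t : ℝ} {v : ℝ → ℝ} (hv : ContinuousOn v (Ioo 0 t)) :
    ContinuousOn (caputoIntegrand α v t) (Ioo 0 t) :=
  (ContinuousOn.rpow_const (by fun_prop) fun _ hs => Or.inl (sub_pos.2 hs.2).ne').mul
    (continuousOn_const.sub hv)

theorem hasCaputo_of_abs_sub_le {α C t : ℝ} (hα : α < 1) {v : ℝ → ℝ}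
    (hv : ContinuousOn v (Ioo 0 t)) (h : ∀ s ∈ Ioo 0 t, |v t - v s| ≤ C * (t - s)) :
    HasCaputo α v t := by
  refine Integrable.mono' ((integrableOn_sub_rpow_neg hα t).const_mul C)
    ((continuousOn_caputoIntegrand α hv).aestronglyMeasurable measurableSet_Ioo) ?_
  exact (ae_restrict_iff' measurableSet_Ioo).2
    (Eventually.of_forall fun s hs => abs_caputoIntegrand_le hs.2 (h s hs))

/-- A function that is bounded on `[0,t]` and Lipschitz on `[ε,t]` satisfies a Lipschitz estimate at
the end point `t`. -/
theorem abs_sub_le_of_lipschitzOn {ε t M : ℝ} {K : ℝ≥0} {v : ℝ → ℝ} (hε : ε < t)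
    (hM : ∀ s ∈ Icc 0 t, |v s| ≤ M) (hK : LipschitzOnWith K v (Icc ε t)) :
    ∀ s ∈ Icc 0 t, |v t - v s| ≤ (K + 2 * M / (t - ε)) * (t - s) := by
  intro s hs
  have hM0 : 0 ≤ M := (abs_nonneg _).trans (hM s hs)
  have hε' : 0 < t - ε := sub_pos.2 hε
  have hts : 0 ≤ t - s := by linarith [hs.2]
  rcases le_or_gt ε s with h | h
  · have h1 := hK.dist_le_mul t ⟨hε.le, le_rfl⟩ s ⟨h, hs.2⟩
    rw [Real.dist_eq, Real.dist_eq, abs_of_nonneg hts] at h1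
    refine h1.trans ?_
    gcongr
    simpa using (by positivity : 0 ≤ 2 * M / (t - ε))
  · have h1 : |v t - v s| ≤ 2 * M := (abs_sub _ _).trans (by
      linarith [hM s hs, hM t ⟨hs.1.trans hs.2, le_rfl⟩])
    calc |v t - v s| ≤ 2 * M := h1
      _ = 2 * M / (t - ε) * (t - ε) := by field_simp
      _ ≤ 2 * M / (t - ε) * (t - s) := by gcongr
      _ ≤ _ := by gcongr; simp

theorem caputo_sub {α t : ℝ} {v w : ℝ → ℝ} (hv : HasCaputo α v t) (hw : HasCaputo α w t) :
    caputo α (fun s => v s - w s) t = caputo α v t - caputo α w t := by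
  have : caputoIntegrand α (fun s => v s - w s) t =
      fun s => caputoIntegrand α v t s - caputoIntegrand α w t s := by
    ext s; simp only [caputoIntegrand]; ring
  simp only [caputo]
  rw [this, integral_sub hv hw]
  ring

theorem HasCaputo.const_mul {α t : ℝ} {v : ℝ → ℝ} (hv : HasCaputo α v t) (m : ℝ) :
    HasCaputo α (fun s => m * v s) t := by
  refine (Integrable.const_mul hv m).congr (Eventually.of_forall fun s => ?_)
  simp only [caputoIntegrand]; ring

theorem caputo_const_mul {α t : ℝ} (v : ℝ → ℝ) (m : ℝ) :
    caputo α (fun s => m * v s) t = m * caputo α v t := by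
  have : caputoIntegrand α (fun s => m * v s) t = fun s => m * caputoIntegrand α v t s := by
    ext s; simp only [caputoIntegrand]; ring
  simp only [caputo]
  rw [this, integral_const_mul]
  ring

/-- The increments carry the positive weights t^(-α) and (t-s)^(-α-1), so it is enough to compare
them at the single time `t`. -/
theorem caputo_le_caputo {α t : ℝ} (hα : α ∈ Ioo (0 : ℝ) 1) (ht : 0 < t) {v w : ℝ → ℝ}
    (hv : HasCaputo α v t) (hw : HasCaputo α w t) (h : ∀ s ∈ Ico 0 t, v t - v s ≤ w t - w s) :
    caputo α v t ≤ caputo α w t := by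
  have hG : 0 < Real.Gamma (1 - α) := Real.Gamma_pos_of_pos (sub_pos.2 hα.2)
  have h0 := h 0 ⟨le_rfl, ht⟩
  have hI : ∫ s in Ioo 0 t, caputoIntegrand α v t s ≤ ∫ s in Ioo 0 t, caputoIntegrand α w t s :=
    setIntegral_mono_on hv hw measurableSet_Ioo fun s hs =>
      mul_le_mul_of_nonneg_left (h s ⟨hs.1.le, hs.2⟩) (Real.rpow_nonneg (sub_pos.2 hs.2).le _)
  have := hα.1
  simp only [caputo]
  gcongr

/-- Strictness comes from the term t^(-α) (z t - z 0). Convergence of the integral is not needed: a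
divergent one has the value 0. -/
theorem caputo_neg_of_isMinOn {α t : ℝ} (hα : α ∈ Ioo (0 : ℝ) 1) (ht : 0 < t) {z : ℝ → ℝ}
    (h0 : z t < z 0) (h : ∀ s ∈ Ioo 0 t, z t ≤ z s) : caputo α z t < 0 := by
  have hG : 0 < Real.Gamma (1 - α) := Real.Gamma_pos_of_pos (sub_pos.2 hα.2)
  have hI : ∫ s in Ioo 0 t, caputoIntegrand α z t s ≤ 0 :=
    setIntegral_nonpos measurableSet_Ioo fun s hs =>
      mul_nonpos_of_nonneg_of_nonpos (Real.rpow_nonneg (sub_pos.2 hs.2).le _)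
        (sub_nonpos.2 (h s hs))
  have h1 : t ^ (-α) * (z t - z 0) < 0 :=
    mul_neg_of_pos_of_neg (Real.rpow_pos_of_pos ht _) (sub_neg.2 h0)
  have h2 := mul_nonpos_of_nonneg_of_nonpos hα.1.le hI
  exact mul_neg_of_pos_of_neg (inv_pos.2 hG) (by linarith)

/-- The comparison principle for `D_t^α + λ`. -/
theorem nonneg_of_caputo_add_nonneg {α lam T : ℝ} (hα : α ∈ Ioo (0 : ℝ) 1) (hlam : 0 ≤ lam)
    {z : ℝ → ℝ} (hz : ContinuousOn z (Ioc 0 T)) (hz0 : 0 ≤ z 0)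
    (hz0' : ∀ ε > 0, ∃ η > 0, ∀ s ∈ Ioo 0 η, -ε < z s)
    (h : ∀ t ∈ Ioc 0 T, 0 ≤ caputo α z t + lam * z t) :
    ∀ t ∈ Ioc 0 T, 0 ≤ z t := by
  intro t₁ ht₁
  by_contra! hneg
  -- `z` may be discontinuous at 0. Staying above the negative value `z t₁` on (0, η) makes the
  -- minimum over [η, T] a minimum over its whole past as well.
  obtain ⟨η, hη, hηz⟩ := hz0' (-z t₁) (by linarith)
  have hηt : η ≤ t₁ := by
    by_contra! hlt
    have := hηz t₁ ⟨ht₁.1, hlt⟩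
    linarith
  obtain ⟨t₀, ht₀, hmin⟩ := isCompact_Icc.exists_isMinOn (s := Icc η T) (f := z)
    ⟨t₁, hηt, ht₁.2⟩ (hz.mono fun s hs => ⟨hη.trans_le hs.1, hs.2⟩)
  have ht₀' : t₀ ∈ Ioc 0 T := ⟨hη.trans_le ht₀.1, ht₀.2⟩
  have h1 : z t₀ ≤ z t₁ := hmin ⟨hηt, ht₁.2⟩
  have h2 := caputo_neg_of_isMinOn hα ht₀'.1 (z := z) (by linarith) fun s hs => by
    rcases lt_or_ge s η with hs' | hs'
    · have := hηz s ⟨hs.1, hs'⟩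
      linarith
    · exact hmin ⟨hs', hs.2.le.trans ht₀.2⟩
  have h3 := h t₀ ht₀'
  have h4 : lam * z t₀ ≤ 0 := mul_nonpos_of_nonneg_of_nonpos hlam (by linarith)
  linarith

/-! ### Convolution on the half-line -/

open scoped Convolution

/-- The convolution of functions on the half-line. -/
def halfConv (f g : ℝ → ℝ) (x : ℝ) : ℝ := ∫ q in Ioo 0 x, f q * g (x - q)

theorem setIntegral_Ioo_comp_sub_left (f : ℝ → ℝ) (x : ℝ) :
    ∫ q in Ioo 0 x, f (x - q) = ∫ q in Ioo 0 x, f q := by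
  rcases le_or_gt x 0 with hx | hx
  · simp [Ioo_eq_empty (not_lt.2 hx)]
  · rw [← integral_Ioc_eq_integral_Ioo, ← integral_Ioc_eq_integral_Ioo,
      ← intervalIntegral.integral_of_le hx.le, ← intervalIntegral.integral_of_le hx.le,
      intervalIntegral.integral_comp_sub_left]
    simp

theorem halfConv_comm (f g : ℝ → ℝ) : halfConv f g = halfConv g f := by
  ext x
  rw [halfConv, ← setIntegral_Ioo_comp_sub_left]
  simp only [sub_sub_cancel, halfConv, mul_comm]

theorem halfConv_of_nonpos (f g : ℝ → ℝ) {x : ℝ} (hx : x ≤ 0) : halfConv f g x = 0 := by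
  simp [halfConv, Ioo_eq_empty (not_lt.2 hx)]

theorem halfConv_congr {f f' g g' : ℝ → ℝ} {x : ℝ} (hf : EqOn f f' (Ioo 0 x))
    (hg : EqOn g g' (Ioo 0 x)) : halfConv f g x = halfConv f' g' x := by
  refine setIntegral_congr_fun measurableSet_Ioo fun q hq => ?_
  simp only [hf hq, hg (show x - q ∈ Ioo 0 x from ⟨by linarith [hq.2], by linarith [hq.1]⟩)]

theorem convolution_eq_halfConv {f g : ℝ → ℝ} (hf : ∀ y ≤ 0, f y = 0) (hg : ∀ y ≤ 0, g y = 0)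
    (x : ℝ) : (f ⋆[ContinuousLinearMap.mul ℝ ℝ, volume] g) x = halfConv f g x := by
  rw [convolution_def, halfConv, ← integral_indicator measurableSet_Ioo]
  refine integral_congr_ae (Eventually.of_forall fun q => ?_)
  simp only [ContinuousLinearMap.mul_apply']
  by_cases hq : q ∈ Ioo 0 x
  · rw [indicator_of_mem hq]
  · rw [indicator_of_notMem hq]
    rcases le_or_gt q 0 with h | h
    · rw [hf q h, zero_mul]
    · rw [hg (x - q) (by by_contra! h'; exact hq ⟨h, by linarith⟩), mul_zero]

theorem convolutionExistsAt_of_bound {f g : ℝ → ℝ} {M : ℝ} (hf : Integrable f)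
    (hg : AEStronglyMeasurable g) (hM : ∀ y, ‖g y‖ ≤ M) (x : ℝ) :
    ConvolutionExistsAt f g x (ContinuousLinearMap.mul ℝ ℝ) :=
  BddAbove.convolutionExistsAt _ ⟨M, by rintro _ ⟨y, -, rfl⟩; exact hM y⟩ MeasurableSet.univ
    (subset_univ _) hf.integrableOn hg

theorem norm_convolution_le {f g : ℝ → ℝ} {M : ℝ} (hf : Integrable f) (hM : ∀ y, ‖g y‖ ≤ M)
    (x : ℝ) : ‖(f ⋆[ContinuousLinearMap.mul ℝ ℝ, volume] g) x‖ ≤ (∫ y, ‖f y‖) * M := by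
  rw [convolution_def, ← integral_mul_const]
  refine norm_integral_le_of_norm_le (hf.norm.mul_const M) (Eventually.of_forall fun y => ?_)
  simp only [ContinuousLinearMap.mul_apply', norm_mul]
  have := hM (x - y)
  gcongr

section Truncated

variable {T : ℝ} {f g w : ℝ → ℝ} {M : ℝ}

theorem indicator_Ioo_of_nonpos (T : ℝ) (f : ℝ → ℝ) : ∀ y ≤ 0, (Ioo 0 T).indicator f y = 0 :=
  fun _ hy => indicator_of_notMem (fun h => absurd h.1 (not_lt.2 hy)) f

theorem eqOn_indicator_Ioo {x : ℝ} (hx : x ≤ T) (f : ℝ → ℝ) :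
    EqOn ((Ioo 0 T).indicator f) f (Ioo 0 x) :=
  fun q hq => indicator_of_mem (show q ∈ Ioo 0 T from ⟨hq.1, hq.2.trans_le hx⟩) f

theorem convolution_indicator_eq_halfConv {x : ℝ} (hx : x ≤ T) :
    ((Ioo 0 T).indicator f ⋆[ContinuousLinearMap.mul ℝ ℝ, volume] (Ioo 0 T).indicator g) x =
      halfConv f g x := by
  rw [convolution_eq_halfConv (indicator_Ioo_of_nonpos T f) (indicator_Ioo_of_nonpos T g)]
  exact halfConv_congr (eqOn_indicator_Ioo hx f) (eqOn_indicator_Ioo hx g)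

theorem norm_indicator_Ioo_le (hM : ∀ y ∈ Ioo 0 T, |w y| ≤ M) (hM0 : 0 ≤ M) (y : ℝ) :
    ‖(Ioo 0 T).indicator w y‖ ≤ M := by
  by_cases hy : y ∈ Ioo 0 T
  · rw [indicator_of_mem hy]; exact hM y hy
  · rw [indicator_of_notMem hy, norm_zero]; exact hM0

/-- Cutting off outside (0, T) reduces this to associativity on the line and changes no value at x ≤
T. Boundedness of `w` makes convolution with it exist everywhere, so the identity holds at each x
and not only almost everywhere. -/
theorem halfConv_assoc (hf : IntegrableOn f (Ioo 0 T)) (hg : IntegrableOn g (Ioo 0 T))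
    (hw : Measurable w) (hM : ∀ y ∈ Ioo 0 T, |w y| ≤ M) (hM0 : 0 ≤ M) {x : ℝ} (hx : x ≤ T) :
    halfConv f (halfConv g w) x = halfConv (halfConv f g) w x := by
  have hF := (integrable_indicator_iff measurableSet_Ioo).2 hf
  have hG := (integrable_indicator_iff measurableSet_Ioo).2 hg
  have hW := norm_indicator_Ioo_le hM hM0
  have hWm : AEStronglyMeasurable ((Ioo 0 T).indicator w) :=
    (hw.indicator measurableSet_Ioo).aestronglyMeasurable
  set F := (Ioo 0 T).indicator f
  set G := (Ioo 0 T).indicator g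
  set W := (Ioo 0 T).indicator w
  have hW' : ∀ y, ‖‖W y‖‖ ≤ M := fun y => by rw [norm_norm]; exact hW y
  have hWi : Integrable W :=
    (integrable_indicator_iff measurableSet_Ioo).2 (Measure.integrableOn_of_bounded
      (M := M) measure_Ioo_lt_top.ne hw.aestronglyMeasurable
      ((ae_restrict_iff' measurableSet_Ioo).2 (Eventually.of_forall hM)))
  have h := convolution_assoc (ContinuousLinearMap.mul ℝ ℝ) (ContinuousLinearMap.mul ℝ ℝ)
    (ContinuousLinearMap.mul ℝ ℝ) (ContinuousLinearMap.mul ℝ ℝ) (f := F) (g := G) (k := W)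
    (μ := volume) (ν := volume) (fun a b c => mul_assoc a b c) (x₀ := x)
    hF.aestronglyMeasurable hG.aestronglyMeasurable hWm
    (hF.ae_convolution_exists _ hG)
    (Eventually.of_forall fun y => convolutionExistsAt_of_bound hG.norm hWm.norm hW' y)
    (convolutionExistsAt_of_bound hF.norm
      (hG.norm.integrable_convolution _ hWi.norm).aestronglyMeasurable
      (fun y => norm_convolution_le hG.norm hW' y) x)
  have hFG : ∀ y ≤ 0, (F ⋆[ContinuousLinearMap.mul ℝ ℝ, volume] G) y = 0 := fun y hy => by
    rw [convolution_eq_halfConv (indicator_Ioo_of_nonpos T f) (indicator_Ioo_of_nonpos T g)]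
    exact halfConv_of_nonpos _ _ hy
  have hGW : ∀ y ≤ 0, (G ⋆[ContinuousLinearMap.mul ℝ ℝ, volume] W) y = 0 := fun y hy => by
    rw [convolution_eq_halfConv (indicator_Ioo_of_nonpos T g) (indicator_Ioo_of_nonpos T w)]
    exact halfConv_of_nonpos _ _ hy
  rw [convolution_eq_halfConv hFG (indicator_Ioo_of_nonpos T w),
    convolution_eq_halfConv (indicator_Ioo_of_nonpos T f) hGW] at h
  calc halfConv f (halfConv g w) x
      = halfConv F (G ⋆[ContinuousLinearMap.mul ℝ ℝ, volume] W) x :=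
        halfConv_congr (eqOn_indicator_Ioo hx f).symm fun q hq =>
          (convolution_indicator_eq_halfConv (hq.2.le.trans hx)).symm
    _ = halfConv (F ⋆[ContinuousLinearMap.mul ℝ ℝ, volume] G) W x := h.symm
    _ = halfConv (halfConv f g) w x :=
        halfConv_congr (fun q hq => convolution_indicator_eq_halfConv (hq.2.le.trans hx))
          (eqOn_indicator_Ioo hx w)

theorem integrableOn_halfConv_integrand (hf : IntegrableOn f (Ioo 0 T))
    (hg : IntegrableOn g (Ioo 0 T)) (hw : Measurable w) (hM : ∀ y ∈ Ioo 0 T, |w y| ≤ M)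
    (hM0 : 0 ≤ M) {x : ℝ} (hx : x ≤ T) :
    IntegrableOn (fun s => f (x - s) * halfConv g w s) (Ioo 0 x) := by
  have hF := (integrable_indicator_iff measurableSet_Ioo).2 hf
  have hG := (integrable_indicator_iff measurableSet_Ioo).2 hg
  have hWm : AEStronglyMeasurable ((Ioo 0 T).indicator w) :=
    (hw.indicator measurableSet_Ioo).aestronglyMeasurable
  have hWi : Integrable ((Ioo 0 T).indicator w) :=
    (integrable_indicator_iff measurableSet_Ioo).2 (Measure.integrableOn_of_bounded
      (M := M) measure_Ioo_lt_top.ne hw.aestronglyMeasurable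
      ((ae_restrict_iff' measurableSet_Ioo).2 (Eventually.of_forall hM)))
  have h := (convolutionExistsAt_of_bound hF
    (hG.integrable_convolution (ContinuousLinearMap.mul ℝ ℝ) hWi).aestronglyMeasurable
    (fun y => norm_convolution_le hG (norm_indicator_Ioo_le hM hM0) y) x).integrable_swap
  refine (h.integrableOn (s := Ioo 0 x)).congr_fun (fun s hs => ?_) measurableSet_Ioo
  simp only [ContinuousLinearMap.mul_apply']
  rw [convolution_indicator_eq_halfConv (hs.2.le.trans hx),
    eqOn_indicator_Ioo hx f ⟨sub_pos.2 hs.2, by linarith [hs.1]⟩]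

end Truncated

/-! ### Inversion of `D_t^α + λ` and positivity of the resolvent kernel -/

/-- The kernel of `D_t^α + λ`, as an operator acting on the derivative. -/
def caputoAddKernel (α lam t : ℝ) : ℝ := caputoKernel α t + lam

theorem integrableOn_caputoAddKernel {α : ℝ} (hα : α < 1) (lam T : ℝ) :
    IntegrableOn (caputoAddKernel α lam) (Ioo 0 T) :=
  (integrableOn_caputoKernel hα T).add (integrableOn_const measure_Ioo_lt_top.ne)

theorem halfConv_resolventKernel_caputoAddKernel {α x : ℝ} (hα : α ∈ Ioo (0 : ℝ) 1) (lam : ℝ)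
    (hx : 0 < x) : halfConv (resolventKernel α lam) (caputoAddKernel α lam) x = 1 := by
  rw [← integral_resolventKernel_mul_caputoKernel hα lam hx, halfConv]
  have h2 : IntegrableOn (fun q => resolventKernel α lam q * lam) (Ioo 0 x) :=
    (integrableOn_resolventKernel hα.1 lam x).mul_const lam
  have h1 : IntegrableOn (fun q => resolventKernel α lam q * caputoKernel α (x - q)) (Ioo 0 x) := by
    have hc : Continuous fun t : ℝ => mittagLeffler α α (-lam * t ^ α) :=
      (continuous_mittagLeffler hα.1 hα.1).comp (continuous_const.mul
        (Continuous.rpow_const continuous_id fun _ => Or.inr hα.1.le))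
    obtain ⟨C, hC⟩ := isCompact_Icc.exists_bound_of_continuousOn (s := Icc 0 x) hc.continuousOn
    have := (integrableOn_rpow_mul_rpow hα.1 (sub_pos.2 hα.2) hx).mul_bdd (c := C)
      hc.aestronglyMeasurable ((ae_restrict_iff' measurableSet_Ioo).2
        (Eventually.of_forall fun t ht => hC t ⟨ht.1.le, ht.2.le⟩))
    refine (this.mul_const (Real.Gamma (1 - α))⁻¹).congr (Eventually.of_forall fun q => ?_)
    simp only [resolventKernel, caputoKernel]
    rw [show 1 - α - 1 = -α by ring]
    ring
  rw [← integral_const_mul]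
  simp only [caputoAddKernel, mul_add, mul_comm lam]
  exact integral_add h1 h2

/-- For Lipschitz functions that vanish at `0`, `D_t^α + λ` is a convolution with the derivative. -/
theorem caputo_add_eq_halfConv {α lam t T : ℝ} (hα : α ∈ Ioo (0 : ℝ) 1) (ht : t ∈ Ioc 0 T)
    {v : ℝ → ℝ} (hv0 : v 0 = 0) {K : ℝ≥0} (hv : LipschitzOnWith K v (Icc 0 T)) :
    caputo α v t + lam * v t = halfConv (caputoAddKernel α lam) (deriv v) t := by
  have hK : ∀ s ∈ Ioo 0 t, |deriv v s| ≤ K := fun s hs => by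
    simpa using norm_deriv_le_of_lipschitzOn (Icc_mem_nhds hs.1 (hs.2.trans_le ht.2)) hv
  have hd : IntegrableOn (deriv v) (Ioo 0 t) :=
    Measure.integrableOn_of_bounded (M := K) measure_Ioo_lt_top.ne
      (measurable_deriv v).aestronglyMeasurable
      ((ae_restrict_iff' measurableSet_Ioo).2 (Eventually.of_forall hK))
  have hi : IntegrableOn (fun s => (t - s) ^ (-α) * deriv v s) (Ioo 0 t) :=
    (integrableOn_sub_rpow_neg hα.2 t).mul_bdd (c := K)
      (measurable_deriv v).aestronglyMeasurable
      ((ae_restrict_iff' measurableSet_Ioo).2 (Eventually.of_forall hK))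
  have hcont : Tendsto v (𝓝[>] 0) (𝓝 (v 0)) := by
    have := (hv.continuousOn 0 ⟨le_rfl, ht.1.le.trans ht.2⟩).mono_left
      (nhdsWithin_mono 0 Ioo_subset_Icc_self)
    rwa [nhdsWithin_Ioo_eq_nhdsGT (ht.1.trans_le ht.2)] at this
  -- This turns λ v into the convolution of v' with the constant λ, the second summand of the
  -- kernel.
  have hac : ∫ s in Ioo 0 t, deriv v s = v t := by
    have := AbsolutelyContinuousOnInterval.integral_deriv_eq_sub (f := v) (a := 0) (b := t)
      (LipschitzOnWith.absolutelyContinuousOnInterval (K := K)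
        (by rw [uIcc_of_le ht.1.le]; exact hv.mono (Icc_subset_Icc_right ht.2)))
    rwa [intervalIntegral.integral_of_le ht.1.le, integral_Ioc_eq_integral_Ioo, hv0, sub_zero]
      at this
  rw [caputo_eq_integral_deriv hα ht.1 hcont
    (fun ε hε => ⟨K, hv.mono (Icc_subset_Icc hε.1.le ht.2)⟩) hi, halfConv_comm, halfConv,
    ← integral_const_mul, ← hac, ← integral_const_mul,
    ← integral_add (hi.const_mul _) (hd.const_mul _)]
  refine integral_congr_ae (Eventually.of_forall fun s => ?_)
  simp only [caputoAddKernel, caputoKernel]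
  ring

/-- The representation of `v` by `(D_t^α + λ) v`. -/
theorem eq_integral_resolventKernel {α lam t T : ℝ} (hα : α ∈ Ioo (0 : ℝ) 1) (ht : t ∈ Ioc 0 T)
    {v : ℝ → ℝ} (hv0 : v 0 = 0) {K : ℝ≥0} (hv : LipschitzOnWith K v (Icc 0 T)) :
    IntegrableOn (fun s => resolventKernel α lam (t - s) * (caputo α v s + lam * v s)) (Ioo 0 t) ∧
    v t = ∫ s in Ioo 0 t, resolventKernel α lam (t - s) * (caputo α v s + lam * v s) := by
  have hK : ∀ s ∈ Ioo 0 T, |deriv v s| ≤ K := fun s hs => by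
    simpa using norm_deriv_le_of_lipschitzOn (Icc_mem_nhds hs.1 hs.2) hv
  have hcongr : EqOn (fun s => resolventKernel α lam (t - s) * (caputo α v s + lam * v s))
      (fun s => resolventKernel α lam (t - s) *
        halfConv (caputoAddKernel α lam) (deriv v) s) (Ioo 0 t) := fun s hs => by
    simp only [caputo_add_eq_halfConv (lam := lam) hα ⟨hs.1, hs.2.le.trans ht.2⟩ hv0 hv]
  have hR := integrableOn_resolventKernel hα.1 lam T
  have hC := integrableOn_caputoAddKernel hα.2 lam T
  constructor
  · exact (integrableOn_halfConv_integrand hR hC (measurable_deriv v) hK K.2 ht.2).congr_fun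
      hcongr.symm measurableSet_Ioo
  · rw [setIntegral_congr_fun measurableSet_Ioo hcongr, ← setIntegral_Ioo_comp_sub_left]
    simp only [sub_sub_cancel]
    -- k * (κ * v') = (k * κ) * v' = 1 * v' = v.
    have h := halfConv_assoc hR hC (measurable_deriv v) hK K.2 ht.2
    rw [halfConv] at h
    rw [h, halfConv_congr (f' := fun _ => 1) (g' := deriv v)
      (fun q hq => halfConv_resolventKernel_caputoAddKernel hα lam hq.1) (fun _ _ => rfl),
      halfConv_comm, halfConv]
    simp only [mul_one]
    have := AbsolutelyContinuousOnInterval.integral_deriv_eq_sub (f := v) (a := 0) (b := t)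
      (LipschitzOnWith.absolutelyContinuousOnInterval (K := K)
        (by rw [uIcc_of_le ht.1.le]; exact hv.mono (Icc_subset_Icc_right ht.2)))
    rw [intervalIntegral.integral_of_le ht.1.le, integral_Ioc_eq_integral_Ioo, hv0, sub_zero]
      at this
    exact this.symm

/-- The inverse of `D_t^α + λ` preserves nonnegativity. -/
theorem halfConv_resolventKernel_nonneg {α lam T : ℝ} (hα : α ∈ Ioo (0 : ℝ) 1) (hlam : 0 ≤ lam)
    (hT : 0 < T) {h : ℝ → ℝ} (hh : ContDiff ℝ 1 h) (hcs : HasCompactSupport h)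
    (hsupp : tsupport h ⊆ Ioi 0) (hnn : ∀ s, 0 ≤ h s) :
    0 ≤ halfConv (resolventKernel α lam) h T := by
  have hz : ∀ y ≤ 0, h y = 0 := fun y hy => by
    by_contra hne
    exact absurd (hsupp (subset_tsupport h hne)) (not_lt.2 hy)
  have hz' : ∀ y ≤ 0, deriv h y = 0 := fun y hy => by
    by_contra hne
    exact absurd (hsupp (support_deriv_subset hne)) (not_lt.2 hy)
  have hdc : Continuous (deriv h) := hh.continuous_deriv le_rfl
  obtain ⟨M, hM⟩ := hdc.bounded_above_of_compact_support hcs.deriv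
  have hM0 : 0 ≤ M := (norm_nonneg _).trans (hM 0)
  have hR := integrableOn_resolventKernel hα.1 lam T
  have hC := integrableOn_caputoAddKernel hα.2 lam T
  have hone : IntegrableOn (fun _ : ℝ => (1 : ℝ)) (Ioo 0 T) :=
    integrableOn_const measure_Ioo_lt_top.ne
  -- `p = k * h'`
  set p : ℝ → ℝ := (Ioo 0 T).indicator (resolventKernel α lam)
    ⋆[ContinuousLinearMap.mul ℝ ℝ, volume] deriv h with hp
  have hRi := (integrable_indicator_iff measurableSet_Ioo).2 hR
  have hpc : Continuous p := BddAbove.continuous_convolution_right_of_integrable _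
    ⟨M, by rintro _ ⟨y, rfl⟩; exact hM y⟩ hRi hdc
  obtain ⟨N, hN⟩ := (⟨_, norm_convolution_le hRi hM⟩ : ∃ N, ∀ x, ‖p x‖ ≤ N)
  have hN0 : 0 ≤ N := (norm_nonneg _).trans (hN 0)
  have hpe : ∀ x ≤ T, p x = halfConv (resolventKernel α lam) (deriv h) x := fun x hx => by
    rw [hp, convolution_eq_halfConv (indicator_Ioo_of_nonpos T _) hz']
    exact halfConv_congr (eqOn_indicator_Ioo hx _) fun _ _ => rfl
  have hprim : ∀ x, halfConv (fun _ => 1) (deriv h) x = h x := fun x => by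
    rcases le_or_gt x 0 with hx | hx
    · rw [halfConv_of_nonpos _ _ hx, hz x hx]
    · rw [halfConv_comm, halfConv]
      simp only [mul_one]
      rw [← integral_Ioc_eq_integral_Ioo, ← intervalIntegral.integral_of_le hx.le,
        intervalIntegral.integral_deriv_eq_sub
          (fun y _ => (hh.differentiable one_ne_zero).differentiableAt)
          (hdc.intervalIntegrable _ _), hz 0 le_rfl, sub_zero]
  -- This is k * h in disguise. As the primitive of a bounded continuous function it is visibly
  -- Lipschitz with v' = p, whence (D_t^α + λ)v = κ * (k * h') = 1 * h' = h.
  set v : ℝ → ℝ := fun t => ∫ s in (0)..t, p s with hv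
  have hder : ∀ t, HasDerivAt v (p t) t := fun t =>
    intervalIntegral.integral_hasDerivAt_right (hpc.intervalIntegrable _ _)
      (hpc.stronglyMeasurableAtFilter _ _) hpc.continuousAt
  have hv0 : v 0 = 0 := by simp [hv]
  have hdv : deriv v = p := funext fun t => (hder t).deriv
  have hLip : LipschitzWith N.toNNReal v :=
    lipschitzWith_of_nnnorm_deriv_le (fun t => (hder t).differentiableAt) fun t => by
      rw [hdv, ← NNReal.coe_le_coe, coe_nnnorm, Real.coe_toNNReal _ hN0]
      exact hN t
  -- `(D_t^α + λ) v = h`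
  have heq : ∀ t ∈ Ioc 0 T, caputo α v t + lam * v t = h t := fun t ht => by
    rw [caputo_add_eq_halfConv hα ht hv0 hLip.lipschitzOnWith, hdv,
      halfConv_congr (f' := caputoAddKernel α lam)
        (g' := halfConv (resolventKernel α lam) (deriv h)) (fun _ _ => rfl)
        (fun q hq => hpe q (hq.2.le.trans ht.2)),
      halfConv_assoc hC hR hdc.measurable (fun y _ => hM y) hM0 ht.2,
      halfConv_comm (caputoAddKernel α lam), ← hprim t]
    exact halfConv_congr
      (fun q hq => halfConv_resolventKernel_caputoAddKernel hα lam hq.1) (fun _ _ => rfl)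
  have hvnn := nonneg_of_caputo_add_nonneg (T := T) (z := v) hα hlam
    hLip.continuous.continuousOn hv0.ge (fun ε hε => by
      have : ∀ᶠ s in 𝓝 (0 : ℝ), -ε < v s :=
        hLip.continuous.continuousAt.eventually_const_lt (by rw [hv0]; linarith)
      obtain ⟨η, hη, hb⟩ := Metric.eventually_nhds_iff.1 this
      exact ⟨η, hη, fun s hs => hb (by rw [Real.dist_eq, sub_zero, abs_of_pos hs.1]; exact hs.2)⟩)
    (fun t ht => by rw [heq t ht]; exact hnn t) T ⟨hT, le_rfl⟩
  -- 1 * (k * h') = k * (1 * h') = k * h.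
  have hfin : v T = halfConv (resolventKernel α lam) h T := by
    calc v T = halfConv (fun _ => 1) (halfConv (resolventKernel α lam) (deriv h)) T := by
          rw [halfConv_comm, halfConv, hv]
          simp only [mul_one]
          rw [intervalIntegral.integral_of_le hT.le, integral_Ioc_eq_integral_Ioo]
          exact setIntegral_congr_fun measurableSet_Ioo fun q hq => hpe q hq.2.le
      _ = halfConv (halfConv (resolventKernel α lam) (fun _ => 1)) (deriv h) T := by
          rw [halfConv_assoc hone hR hdc.measurable (fun y _ => hM y) hM0 le_rfl,
            halfConv_comm (fun _ => 1)]
      _ = halfConv (resolventKernel α lam) h T := by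
          rw [← halfConv_assoc hR hone hdc.measurable (fun y _ => hM y) hM0 le_rfl]
          exact halfConv_congr (fun _ _ => rfl) fun q _ => hprim q
  rwa [← hfin]

/-- If the kernel were negative at x, it would be so near x, and its convolution with a suitable
nonnegative bump would be negative at some point. -/
theorem resolventKernel_nonneg {α lam x : ℝ} (hα : α ∈ Ioo (0 : ℝ) 1) (hlam : 0 ≤ lam)
    (hx : 0 < x) : 0 ≤ resolventKernel α lam x := by
  by_contra! hneg
  have hev : ∀ᶠ y in 𝓝 x, resolventKernel α lam y < 0 ∧ 0 < y :=
    (((continuousOn_resolventKernel hα.1 lam).continuousAt (Ioi_mem_nhds hx)).eventually_lt_const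
      hneg).and (lt_mem_nhds hx)
  obtain ⟨η, hη, hball⟩ := Metric.eventually_nhds_iff.1 hev
  -- The bump sits around η, hence inside (0, ∞). Evaluating the convolution at x + η keeps the
  -- argument of the kernel within η/2 of x.
  let φ : ContDiffBump η := ⟨η / 4, η / 2, by linarith, by linarith⟩
  have hts : tsupport φ = Icc (η - η / 2) (η + η / 2) := by
    rw [φ.tsupport_eq, Real.closedBall_eq_Icc]
  have hts0 : tsupport φ ⊆ Ioi 0 := by
    rw [hts]
    intro y hy
    have := hy.1
    show 0 < y
    linarith
  have h := halfConv_resolventKernel_nonneg (lam := lam) (T := x + η) hα hlam (by linarith)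
    φ.contDiff φ.hasCompactSupport hts0 fun s => φ.nonneg
  rw [halfConv_comm, halfConv] at h
  have hI : ∀ y ∈ Icc (η - η / 2) (η + η / 2), resolventKernel α lam (x + η - y) < 0 ∧
      0 < x + η - y := fun y hy => by
    refine hball ?_
    rw [Real.dist_eq, abs_lt]
    constructor <;> linarith [hy.1, hy.2]
  have hle : ∀ q, φ q * resolventKernel α lam (x + η - q) ≤ 0 := fun q => by
    by_cases hq : q ∈ tsupport φ
    · exact mul_nonpos_of_nonneg_of_nonpos φ.nonneg (hI q (hts ▸ hq)).1.le
    · rw [image_eq_zero_of_notMem_tsupport hq, zero_mul]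
  have hcont : ContinuousOn (fun q => φ q * resolventKernel α lam (x + η - q))
      (Icc (η - η / 2) (η + η / 2)) :=
    φ.continuous.continuousOn.mul ((continuousOn_resolventKernel hα.1 lam).comp
      (by fun_prop) fun q hq => (hI q hq).2)
  have hsub : Icc (η - η / 2) (η + η / 2) ⊆ Ioo 0 (x + η) := fun y hy =>
    ⟨by linarith [hy.1], by linarith [(hI y hy).2]⟩
  have hrestr : ∫ q in Ioo 0 (x + η), φ q * resolventKernel α lam (x + η - q) =
      ∫ q in (η - η / 2)..(η + η / 2), φ q * resolventKernel α lam (x + η - q) := by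
    rw [intervalIntegral.integral_of_le (by linarith), ← integral_Icc_eq_integral_Ioc]
    refine setIntegral_eq_of_subset_of_forall_sdiff_eq_zero measurableSet_Ioo hsub fun q hq => ?_
    have : φ q = 0 := image_eq_zero_of_notMem_tsupport (by rw [hts]; exact hq.2)
    rw [this, zero_mul]
  have hpos : 0 < ∫ q in (η - η / 2)..(η + η / 2), -(φ q * resolventKernel α lam (x + η - q)) := by
    refine intervalIntegral.integral_pos (by linarith) hcont.neg
      (fun q _ => neg_nonneg.2 (hle q)) ⟨η, ⟨by linarith, by linarith⟩, ?_⟩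
    rw [neg_pos]
    refine mul_neg_of_pos_of_neg (φ.pos_of_mem_ball ?_) (hI η ⟨by linarith, by linarith⟩).1
    exact Metric.mem_ball_self (by show 0 < η / 2; linarith)
  rw [intervalIntegral.integral_neg, ← hrestr] at hpos
  linarith

/-! ### Scalar subsolutions: comparison, the integral bound, general barriers -/

section Scalar

variable {α lam T : ℝ} {m : ℝ → ℝ} {g : ℝ → ℝ≥0∞}

theorem hasCaputo_of_lipschitzOnWith {α T : ℝ} (hα : α < 1) {v : ℝ → ℝ} {K : ℝ≥0}
    (hv : LipschitzOnWith K v (Icc 0 T)) {t : ℝ} (ht : t ∈ Ioc 0 T) : HasCaputo α v t := by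
  refine hasCaputo_of_abs_sub_le (C := K) hα
    (hv.continuousOn.mono fun s hs => ⟨hs.1.le, hs.2.le.trans ht.2⟩) fun s hs => ?_
  have h := hv.dist_le_mul t ⟨ht.1.le, ht.2⟩ s ⟨hs.1.le, hs.2.le.trans ht.2⟩
  rwa [Real.dist_eq, Real.dist_eq, abs_of_pos (sub_pos.2 hs.2)] at h

theorem hasCaputo_of_locally_lipschitz {α T : ℝ} (hα : α < 1) {v : ℝ → ℝ}
    (hv : ContinuousOn v (Icc 0 T)) (hL : ∀ ε > 0, ∃ K : ℝ≥0, LipschitzOnWith K v (Icc ε T))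
    {t : ℝ} (ht : t ∈ Ioc 0 T) : HasCaputo α v t := by
  obtain ⟨M, hM⟩ := isCompact_Icc.exists_bound_of_continuousOn hv
  obtain ⟨K, hK⟩ := hL (t / 2) (by linarith [ht.1])
  have h := abs_sub_le_of_lipschitzOn (t := t) (v := v) (M := M) (half_lt_self ht.1)
    (fun s hs => hM s ⟨hs.1, hs.2.trans ht.2⟩) (hK.mono (Icc_subset_Icc_right ht.2))
  exact hasCaputo_of_abs_sub_le hα (hv.mono fun s hs => ⟨hs.1.le, hs.2.le.trans ht.2⟩)
    fun s hs => h s ⟨hs.1.le, hs.2.le⟩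

/-- Comparison for E - m. A jump of `E` at 0 is harmless: near 0 only E ≥ 0 and m → 0 matter. -/
theorem le_of_caputo_add_le (hα : α ∈ Ioo (0 : ℝ) 1) (hlam : 0 ≤ lam)
    (hmc : ContinuousOn m (Icc 0 T)) (hm0 : m 0 = 0)
    (hmL : ∀ ε > 0, ∃ K : ℝ≥0, LipschitzOnWith K m (Icc ε T))
    {E : ℝ → ℝ} (hE : ContinuousOn E (Ioc 0 T)) (hE0 : ∀ t ∈ Icc 0 T, 0 ≤ E t)
    (hEC : ∀ t ∈ Ioc 0 T, HasCaputo α E t)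
    (h : ∀ t ∈ Ioc 0 T, caputo α m t + lam * m t ≤ caputo α E t + lam * E t) :
    ∀ t ∈ Icc 0 T, m t ≤ E t := by
  intro t ht
  rcases eq_or_lt_of_le ht.1 with rfl | ht0
  · rw [hm0]; exact hE0 0 ht
  have hT : 0 < T := ht0.trans_le ht.2
  refine sub_nonneg.1 (nonneg_of_caputo_add_nonneg (z := fun s => E s - m s) hα hlam
    (hE.sub (hmc.mono Ioc_subset_Icc_self)) ?_ ?_ ?_ t ⟨ht0, ht.2⟩)
  · simpa [hm0] using hE0 0 ⟨le_rfl, hT.le⟩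
  · intro ε hε
    have h1 : ∀ᶠ s in 𝓝[Icc 0 T] 0, m s < ε :=
      (hmc 0 ⟨le_rfl, hT.le⟩).eventually_lt_const (by rw [hm0]; exact hε)
    obtain ⟨η, hη, hb⟩ := Metric.mem_nhdsWithin_iff.1 h1
    refine ⟨min η T, lt_min hη hT, fun s hs => ?_⟩
    have hsT : s ∈ Icc 0 T := ⟨hs.1.le, hs.2.le.trans (min_le_right _ _)⟩
    have h2 : m s < ε := hb ⟨by
      rw [Metric.mem_ball, Real.dist_eq, sub_zero, abs_of_pos hs.1]
      exact hs.2.trans_le (min_le_left _ _), hsT⟩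
    have := hE0 s hsT
    linarith
  · intro s hs
    rw [caputo_sub (hEC s hs) (hasCaputo_of_locally_lipschitz hα.2 hmc hmL hs)]
    linarith [h s hs]

theorem ofReal_integral_le_lintegral {β : Type*} [MeasurableSpace β] {μ : Measure β} {f : β → ℝ}
    (hf : Integrable f μ) : ENNReal.ofReal (∫ x, f x ∂μ) ≤ ∫⁻ x, ENNReal.ofReal (f x) ∂μ := by
  calc ENNReal.ofReal (∫ x, f x ∂μ) ≤ ENNReal.ofReal (∫ x, max (f x) 0 ∂μ) :=
        ENNReal.ofReal_le_ofReal (integral_mono hf hf.pos_part fun _ => le_max_left _ _)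
    _ = ∫⁻ x, ENNReal.ofReal (max (f x) 0) ∂μ :=
        ofReal_integral_eq_lintegral_ofReal hf.pos_part
          (Eventually.of_forall fun _ => le_max_right _ _)
    _ = _ := by simp [ENNReal.ofReal_max]

theorem ofReal_le_invCaputoAdd_of_lipschitz (hα : α ∈ Ioo (0 : ℝ) 1) (hlam : 0 ≤ lam)
    {v : ℝ → ℝ} {K : ℝ≥0} (hv : LipschitzOnWith K v (Icc 0 T)) (hv0 : v 0 = 0)
    (h : ∀ t ∈ Ioc 0 T, ENNReal.ofReal (caputo α v t + lam * v t) ≤ g t) :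
    ∀ t ∈ Ioc 0 T, ENNReal.ofReal (v t) ≤ invCaputoAdd α lam g t := by
  intro t ht
  obtain ⟨hi, he⟩ := eq_integral_resolventKernel (lam := lam) hα ht hv0 hv
  rw [he]
  refine (ofReal_integral_le_lintegral hi).trans ?_
  refine setLIntegral_mono' measurableSet_Ioo fun s hs => ?_
  rw [ENNReal.ofReal_mul (resolventKernel_nonneg hα hlam (sub_pos.2 hs.2))]
  exact mul_le_mul_right (h s ⟨hs.1, hs.2.le.trans ht.2⟩) _

/-- A function with `m 0 = 0` and `(D_t^α + λ) m ≤ g` is bounded above by `(D_t^α + λ)⁻¹ g`. -/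
theorem ofReal_le_invCaputoAdd (hα : α ∈ Ioo (0 : ℝ) 1) (hlam : 0 ≤ lam)
    (hmc : ContinuousOn m (Icc 0 T)) (hm0 : m 0 = 0)
    (hmL : ∀ ε > 0, ∃ K : ℝ≥0, LipschitzOnWith K m (Icc ε T))
    (h : ∀ t ∈ Ioc 0 T, ENNReal.ofReal (caputo α m t + lam * m t) ≤ g t) :
    ∀ t ∈ Ioc 0 T, ENNReal.ofReal (m t) ≤ invCaputoAdd α lam g t := by
  intro t ht
  have hT : 0 < T := ht.1.trans_le ht.2
  have key : ∀ δ > 0, ENNReal.ofReal (m t - δ) ≤ invCaputoAdd α lam g t := by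
    intro δ hδ
    have h1 : ∀ᶠ s in 𝓝[Icc 0 T] 0, m s < δ :=
      (hmc 0 ⟨le_rfl, hT.le⟩).eventually_lt_const (by rw [hm0]; exact hδ)
    obtain ⟨r, hr, hb⟩ := Metric.mem_nhdsWithin_iff.1 h1
    set η := min (r / 2) T with hη
    have hη0 : 0 < η := lt_min (by linarith) hT
    have hsmall : ∀ s ∈ Icc 0 η, m s < δ := fun s hs => hb ⟨by
      rw [Metric.mem_ball, Real.dist_eq, sub_zero, abs_of_nonneg hs.1]
      linarith [hs.2, min_le_left (r / 2) T], hs.1, hs.2.trans (min_le_right _ _)⟩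
    obtain ⟨K, hK⟩ := hmL η hη0
    -- `m` may fail to be Lipschitz at 0. This truncation vanishes on [0, η], is therefore Lipschitz
    -- up to 0, and is still a subsolution.
    set v : ℝ → ℝ := fun s => max (m s - δ) 0 with hv
    have hvsmall : ∀ s ∈ Icc 0 η, v s = 0 := fun s hs =>
      max_eq_right (by linarith [hsmall s hs])
    have hvL : LipschitzOnWith K v (Icc 0 T) := by
      refine LipschitzOnWith.of_dist_le_mul fun x hx y hy => ?_
      -- Since v factors through z ↦ max η z, the Lipschitz constant of `m` on [η, T] serves on [0,
      -- T].
      have hcut : ∀ z ∈ Icc 0 T, v z = v (max η z) := fun z hz => by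
        rcases le_total η z with h' | h'
        · rw [max_eq_right h']
        · rw [max_eq_left h', hvsmall z ⟨hz.1, h'⟩, hvsmall η ⟨hη0.le, le_rfl⟩]
      have hmem : ∀ z ∈ Icc 0 T, max η z ∈ Icc η T := fun z hz =>
        ⟨le_max_left _ _, max_le (min_le_right _ _) hz.2⟩
      rw [hcut x hx, hcut y hy]
      have h2 := hK.dist_le_mul _ (hmem x hx) _ (hmem y hy)
      rw [Real.dist_eq, Real.dist_eq] at h2 ⊢
      have h3 : |max η x - max η y| ≤ |x - y| := by
        have := abs_max_sub_max_le_abs x y η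
        rwa [max_comm η x, max_comm η y]
      calc |v (max η x) - v (max η y)| ≤ |(m (max η x) - δ) - (m (max η y) - δ)| :=
            abs_max_sub_max_le_abs _ _ _
        _ = |m (max η x) - m (max η y)| := by rw [sub_sub_sub_cancel_right]
        _ ≤ K * |max η x - max η y| := h2
        _ ≤ K * dist x y := by rw [Real.dist_eq]; gcongr
    have hv0 : v 0 = 0 := hvsmall 0 ⟨le_rfl, hη0.le⟩
    have hsub : ∀ s ∈ Ioc 0 T, ENNReal.ofReal (caputo α v s + lam * v s) ≤ g s := by
      intro s hs
      have hvC := hasCaputo_of_lipschitzOnWith hα.2 hvL hs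
      have hmC := hasCaputo_of_locally_lipschitz hα.2 hmc hmL hs
      rcases le_or_gt (m s) δ with hle | hgt
      -- Where v vanishes, its increments from the past are nonpositive, so its Caputo derivative is
      -- too.
      · have hvs : v s = 0 := max_eq_right (by linarith)
        have hzero : HasCaputo α (fun _ => (0 : ℝ)) s :=
          hasCaputo_of_abs_sub_le (C := 0) hα.2 continuousOn_const (by simp)
        have h4 := caputo_le_caputo hα hs.1 hvC hzero fun q _ => by
          rw [hvs, zero_sub, sub_zero, neg_nonpos]; exact le_max_right _ _
        have h5 : caputo α (fun _ => (0 : ℝ)) s = 0 := by simp [caputo, caputoIntegrand]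
        rw [hvs, mul_zero, add_zero, ENNReal.ofReal_of_nonpos (h4.trans h5.le)]
        exact zero_le
      -- Here v equals m - δ at s and is at least m - δ before, so its increments are dominated by
      -- those of `m`.
      · have hvs : v s = m s - δ := max_eq_left (by linarith)
        have h4 := caputo_le_caputo hα hs.1 hvC hmC fun q _ => by
          have : m q - δ ≤ v q := le_max_left _ _
          linarith
        refine (ENNReal.ofReal_le_ofReal (add_le_add h4 ?_)).trans (h s hs)
        exact mul_le_mul_of_nonneg_left (by linarith) hlam
    refine le_trans (ENNReal.ofReal_le_ofReal (le_max_left _ _))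
      (ofReal_le_invCaputoAdd_of_lipschitz hα hlam hvL hv0 hsub t ht)
  have hlim : Tendsto (fun δ => ENNReal.ofReal (m t - δ)) (𝓝[>] 0) (𝓝 (ENNReal.ofReal (m t))) := by
    have : Continuous fun δ : ℝ => ENNReal.ofReal (m t - δ) :=
      ENNReal.continuous_ofReal.comp (by fun_prop)
    have := this.tendsto 0
    rw [sub_zero] at this
    exact this.mono_left nhdsWithin_le_nhds
  exact le_of_tendsto hlim (eventually_mem_nhdsWithin.mono key)

/-- The bound by a barrier `B` and the supremum of `g / ((D_t^α + λ) B)`. -/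
theorem ofReal_le_mul_iSup_div (hα : α ∈ Ioo (0 : ℝ) 1) (hlam : 0 ≤ lam)
    (hmc : ContinuousOn m (Icc 0 T)) (hm0 : m 0 = 0)
    (hmL : ∀ ε > 0, ∃ K : ℝ≥0, LipschitzOnWith K m (Icc ε T))
    (h : ∀ t ∈ Ioc 0 T, ENNReal.ofReal (caputo α m t + lam * m t) ≤ g t)
    {B r : ℝ → ℝ} (hB : ContinuousOn B (Ioi 0)) (hB0 : 0 ≤ B 0) (hBpos : ∀ t > 0, 0 < B t)
    (hBC : ∀ t > 0, HasCaputo α B t) (hr : ∀ t > 0, 0 < r t)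
    (hBr : ∀ t > 0, caputo α B t + lam * B t = r t) :
    ∀ t ∈ Ioc 0 T, ENNReal.ofReal (m t) ≤
      ENNReal.ofReal (B t) * ⨆ s ∈ Ioc 0 t, g s / ENNReal.ofReal (r s) := by
  intro t ht
  set S := ⨆ s ∈ Ioc 0 t, g s / ENNReal.ofReal (r s) with hS
  rcases eq_or_ne S ⊤ with htop | htop
  · rw [htop, ENNReal.mul_top (ENNReal.ofReal_pos.2 (hBpos t ht.1)).ne']
    exact le_top
  have hle : ∀ s ∈ Ioc 0 t, g s ≤ S * ENNReal.ofReal (r s) := fun s hs => by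
    rw [← ENNReal.div_le_iff (ENNReal.ofReal_pos.2 (hr s hs.1)).ne' ENNReal.ofReal_ne_top]
    exact le_iSup₂ (f := fun s (_ : s ∈ Ioc 0 t) => g s / ENNReal.ofReal (r s)) s hs
  have hSr : S = ENNReal.ofReal S.toReal := (ENNReal.ofReal_toReal htop).symm
  have hM : 0 ≤ S.toReal := ENNReal.toReal_nonneg
  -- S · B is a supersolution by linearity. The comparison stops at `t` because S controls `g` only
  -- on (0, t].
  have hmain := le_of_caputo_add_le (T := t) (E := fun s => S.toReal * B s) hα hlam
    (hmc.mono (Icc_subset_Icc_right ht.2)) hm0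
    (fun ε hε => (hmL ε hε).imp fun K hK => hK.mono (Icc_subset_Icc_right ht.2))
    (continuousOn_const.mul (hB.mono fun s hs => hs.1))
    (fun s hs => by
      rcases eq_or_lt_of_le hs.1 with h0 | h0
      · rw [← h0]; exact mul_nonneg hM hB0
      · exact mul_nonneg hM (hBpos s h0).le)
    (fun s hs => (hBC s hs.1).const_mul _) (fun s hs => by
      have h1 := (h s ⟨hs.1, hs.2.trans ht.2⟩).trans (hle s hs)
      rw [hSr, ← ENNReal.ofReal_mul hM,
        ENNReal.ofReal_le_ofReal_iff (mul_nonneg hM (hr s hs.1).le), ← hBr s hs.1] at h1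
      rw [caputo_const_mul]
      linarith) t ⟨ht.1.le, le_rfl⟩
  rw [hSr, ← ENNReal.ofReal_mul (hBpos t ht.1).le, mul_comm]
  exact ENNReal.ofReal_le_ofReal hmain

end Scalar

/-! ### Caputo derivatives of the barriers -/

section Barrier

/-- The jump of a function at `0` contributes to its Caputo derivative. -/
theorem caputo_ite_eq (α : ℝ) {t : ℝ} (ht : 0 < t) (W : ℝ → ℝ) :
    caputo α (fun s => if s ≤ 0 then 0 else W s) t =
      caputo α W t + (Real.Gamma (1 - α))⁻¹ * t ^ (-α) * W 0 := by
  have : ∫ s in Ioo 0 t, caputoIntegrand α (fun s => if s ≤ 0 then 0 else W s) t s =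
      ∫ s in Ioo 0 t, caputoIntegrand α W t s :=
    setIntegral_congr_fun measurableSet_Ioo fun s hs => by
      simp [caputoIntegrand, not_le.2 ht, not_le.2 hs.1]
  simp only [caputo]
  rw [this]
  simp only [not_le.2 ht, le_rfl, if_true, if_false]
  ring

theorem hasCaputo_ite {α : ℝ} {t : ℝ} (ht : 0 < t) {W : ℝ → ℝ} (hW : HasCaputo α W t) :
    HasCaputo α (fun s => if s ≤ 0 then 0 else W s) t :=
  IntegrableOn.congr_fun hW (fun s hs => by
    simp [caputoIntegrand, not_le.2 ht, not_le.2 hs.1]) measurableSet_Ioo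

theorem continuousOn_ite {W : ℝ → ℝ} (hW : ContinuousOn W (Ioi 0)) :
    ContinuousOn (fun s => if s ≤ 0 then 0 else W s) (Ioi 0) :=
  hW.congr fun s hs => by simp [not_le.2 (show 0 < s from hs)]

/-- For s < 1 this is Bernoulli's inequality (1-s)^β ≤ 1 - βs with 0 < β = 1 - α < 1. -/
theorem le_rho {α s : ℝ} (hα : α ∈ Ioo (0 : ℝ) 1) (hs : 0 < s) :
    s ^ (-(1 - α)) * min ((1 - α) * s) 1 ≤ rho α s := by
  refine mul_le_mul_of_nonneg_left ?_ (Real.rpow_nonneg hs.le _)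
  rcases le_or_gt 1 s with h | h
  · rw [max_eq_left (by linarith), Real.zero_rpow (by linarith [hα.2]), sub_zero]
    exact min_le_right _ _
  · rw [max_eq_right (by linarith)]
    have := rpow_one_add_le_one_add_mul_self (s := -s) (p := 1 - α) (by linarith)
      (by linarith [hα.2]) (by linarith [hα.1])
    rw [← sub_eq_add_neg] at this
    exact (min_le_left _ _).trans (by linarith)

theorem rho_pos {α s : ℝ} (hα : α ∈ Ioo (0 : ℝ) 1) (hs : 0 < s) : 0 < rho α s :=
  lt_of_lt_of_le (mul_pos (Real.rpow_pos_of_pos hs _)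
    (lt_min (mul_pos (sub_pos.2 hα.2) hs) one_pos)) (le_rho hα hs)

theorem barrierR₀_pos {α lam t : ℝ} (hα : α ∈ Ioo (0 : ℝ) 1) (hlam : 0 ≤ lam) (ht : 0 < t) :
    0 < barrierR₀ α lam t := by
  have hG : 0 < Real.Gamma (1 - α) := Real.Gamma_pos_of_pos (sub_pos.2 hα.2)
  rw [barrierR₀]
  positivity

theorem barrierE₁_pos {α τ t : ℝ} (hτ : 0 < τ) : 0 < barrierE₁ α τ t :=
  Real.rpow_pos_of_pos (lt_max_of_lt_left hτ) _

theorem barrierR₁_pos {α lam τ t : ℝ} (hα : α ∈ Ioo (0 : ℝ) 1) (hlam : 0 ≤ lam) (hτ : 0 < τ)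
    (ht : 0 < t) : 0 < barrierR₁ α lam τ t := by
  have hG : 0 < Real.Gamma (1 - α) := Real.Gamma_pos_of_pos (sub_pos.2 hα.2)
  have h1 := rho_pos hα (div_pos hτ ht)
  have h2 := barrierE₁_pos (α := α) (t := t) hτ
  rw [barrierR₁]
  positivity

theorem exists_lipschitzWith_barrierE₁ {α τ : ℝ} (hα : α ∈ Ioo (0 : ℝ) 1) (hτ : 0 < τ) :
    ∃ K : ℝ≥0, LipschitzWith K (barrierE₁ α τ) := by
  have hC : 0 ≤ (1 - α) * τ ^ (α - 2) :=
    mul_nonneg (sub_pos.2 hα.2).le (Real.rpow_nonneg hτ.le _)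
  have hd : ∀ x ∈ Ici τ, HasDerivAt (fun x : ℝ => x ^ (α - 1)) ((α - 1) * x ^ (α - 1 - 1)) x :=
    fun x hx => Real.hasDerivAt_rpow_const (Or.inl (hτ.trans_le hx).ne')
  have h1 : LipschitzOnWith ((1 - α) * τ ^ (α - 2)).toNNReal (fun x : ℝ => x ^ (α - 1)) (Ici τ) := by
    refine (convex_Ici τ).lipschitzOnWith_of_nnnorm_deriv_le
      (fun x hx => (hd x hx).differentiableAt) fun x hx => ?_
    rw [← NNReal.coe_le_coe, coe_nnnorm, Real.coe_toNNReal _ hC, (hd x hx).deriv, norm_mul,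
      Real.norm_eq_abs, Real.norm_eq_abs, abs_of_neg (by linarith [hα.2]),
      abs_of_pos (Real.rpow_pos_of_pos (hτ.trans_le hx) _), neg_sub, show α - 1 - 1 = α - 2 by ring]
    exact mul_le_mul_of_nonneg_left
      (Real.rpow_le_rpow_of_nonpos hτ hx (by linarith [hα.2])) (sub_pos.2 hα.2).le
  refine ⟨((1 - α) * τ ^ (α - 2)).toNNReal * 1, ?_⟩
  rw [← lipschitzOnWith_univ]
  exact h1.comp (g := fun x : ℝ => x ^ (α - 1)) (f := fun x => max τ x)
    ((LipschitzWith.id.const_max τ).lipschitzOnWith) fun x _ =>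
      (le_max_left τ x : τ ≤ max τ x)

/-- The second term on the left is the effect of a jump from 0 to τ^(α-1) at time 0. It yields the
summand 1 in the bracket of ρ; the decay after τ yields the other summand. -/
theorem caputo_barrierE₁ {α τ t : ℝ} (hα : α ∈ Ioo (0 : ℝ) 1) (hτ : 0 < τ) (ht : 0 < t) :
    caputo α (barrierE₁ α τ) t + (Real.Gamma (1 - α))⁻¹ * t ^ (-α) * barrierE₁ α τ 0 =
      (Real.Gamma (1 - α))⁻¹ * t⁻¹ * rho α (τ / t) := by
  obtain ⟨K, hK⟩ := exists_lipschitzWith_barrierE₁ hα hτ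
  have hi : IntegrableOn (fun s => (t - s) ^ (-α) * deriv (barrierE₁ α τ) s) (Ioo 0 t) :=
    (integrableOn_sub_rpow_neg hα.2 t).mul_bdd (c := K)
      (measurable_deriv _).aestronglyMeasurable
      (Eventually.of_forall fun s => norm_deriv_le_of_lipschitz hK)
  rw [caputo_eq_integral_deriv hα ht
    (hK.continuous.continuousAt.tendsto.mono_left nhdsWithin_le_nhds)
    (fun ε _ => ⟨K, hK.lipschitzOnWith⟩) hi]
  have hW0 : barrierE₁ α τ 0 = τ ^ (α - 1) := by rw [barrierE₁, max_eq_left hτ.le]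
  have hconst : ∀ s < τ, deriv (barrierE₁ α τ) s = 0 := fun s hs => by
    have : barrierE₁ α τ =ᶠ[𝓝 s] fun _ => τ ^ (α - 1) := by
      filter_upwards [Iio_mem_nhds hs] with q hq
      rw [barrierE₁, max_eq_left (le_of_lt hq)]
    rw [this.deriv_eq, deriv_const]
  have hpow : t⁻¹ * (τ / t) ^ (-(1 - α)) = t ^ (-α) * τ ^ (α - 1) := by
    rw [Real.div_rpow hτ.le ht.le, ← Real.rpow_neg_one t, show -(1 - α) = α - 1 by ring,
      div_eq_mul_inv, ← Real.rpow_neg ht.le, mul_left_comm, ← Real.rpow_add ht, mul_comm]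
    congr 2
    ring
  rw [hW0]
  rcases le_or_gt t τ with htτ | htτ
  · have h0 : ∫ s in Ioo 0 t, (t - s) ^ (-α) * deriv (barrierE₁ α τ) s = 0 :=
      setIntegral_eq_zero_of_forall_eq_zero fun s hs => by
        rw [hconst s (hs.2.trans_le htτ), mul_zero]
    have h1 : 1 ≤ τ / t := by rwa [le_div_iff₀ ht, one_mul]
    rw [h0, rho, max_eq_left (by linarith), Real.zero_rpow (by linarith [hα.2]), sub_zero, mul_one,
      mul_assoc _ t⁻¹, hpow]
    ring
  -- An antiderivative of (α-1) (t-s)^(-α) s^(α-2) that vanishes at s = t.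
  · set G : ℝ → ℝ := fun s => t⁻¹ * ((t - s) / s) ^ (1 - α) with hG
    have hWd : ∀ s ∈ Ioo τ t, deriv (barrierE₁ α τ) s = (α - 1) * s ^ (α - 1 - 1) := fun s hs => by
      have : barrierE₁ α τ =ᶠ[𝓝 s] fun q => q ^ (α - 1) := by
        filter_upwards [Ioi_mem_nhds hs.1] with q hq
        rw [barrierE₁, max_eq_right (le_of_lt hq)]
      rw [this.deriv_eq]
      exact (Real.hasDerivAt_rpow_const (Or.inl (hτ.trans hs.1).ne')).deriv
    have hGd : ∀ s ∈ Ioo τ t,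
        HasDerivAt G ((t - s) ^ (-α) * deriv (barrierE₁ α τ) s) s := fun s hs => by
      have hs0 : 0 < s := hτ.trans hs.1
      have hts : 0 < t - s := sub_pos.2 hs.2
      have h1 := ((((hasDerivAt_id s).const_sub t).div (hasDerivAt_id s) hs0.ne').rpow_const
        (p := 1 - α) (Or.inl (div_pos hts hs0).ne')).const_mul t⁻¹
      refine h1.congr_deriv ?_
      simp only [id, Pi.div_apply]
      rw [hWd s hs, show 1 - α - 1 = -α by ring, Real.div_rpow hts.le hs0.le, Real.rpow_neg hs0.le,
        show α - 1 - 1 = α - (2 : ℕ) by push_cast; ring, Real.rpow_sub_natCast hs0.ne']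
      field_simp
      ring
    have hGc : ContinuousOn G (Icc τ t) := by
      refine continuousOn_const.mul (ContinuousOn.rpow_const ?_ fun _ _ =>
        Or.inr (sub_pos.2 hα.2).le)
      exact ContinuousOn.div (by fun_prop) continuousOn_id fun s hs => (hτ.trans_le hs.1).ne'
    have h1 : ∫ s in Ioo 0 t, (t - s) ^ (-α) * deriv (barrierE₁ α τ) s = G t - G τ := by
      rw [← intervalIntegral.integral_eq_sub_of_hasDerivAt_of_le htτ.le hGc hGd
        ((intervalIntegrable_iff_integrableOn_Ioo_of_le htτ.le).2
          (hi.mono_set (Ioo_subset_Ioo_left hτ.le))), intervalIntegral.integral_of_le htτ.le,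
        integral_Ioc_eq_integral_Ioo, ← integral_Ico_eq_integral_Ioo (x := τ)]
      -- The kink s = τ belongs to the smaller set [τ, t), so the integrand has to vanish only for s
      -- < τ.
      refine setIntegral_eq_of_subset_of_forall_sdiff_eq_zero measurableSet_Ioo
        (fun s hs => ⟨hτ.trans_le hs.1, hs.2⟩) fun s hs => ?_
      rw [hconst s (by by_contra! h; exact hs.2 ⟨h, hs.1.2⟩), mul_zero]
    have hlt : τ / t < 1 := by rwa [div_lt_one ht]
    have h2 : (τ / t) ^ (-(1 - α)) * (1 - τ / t) ^ (1 - α) = ((t - τ) / τ) ^ (1 - α) := by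
      rw [Real.rpow_neg (div_pos hτ ht).le, ← Real.inv_rpow (div_pos hτ ht).le,
        ← Real.mul_rpow (inv_nonneg.2 (div_pos hτ ht).le) (by linarith)]
      congr 1
      field_simp
    rw [h1, hG, rho, max_eq_right (by linarith)]
    simp only [sub_self, zero_div]
    rw [Real.zero_rpow (by linarith [hα.2]), mul_one_sub, h2, mul_zero, zero_sub,
      mul_sub, mul_assoc _ t⁻¹ ((τ / t) ^ (-(1 - α))), hpow]
    ring

end Barrier

/-! ### Scalar bounds with the barriers `𝓡₀` and `𝓡₁` -/

section Scalar

variable {α lam T : ℝ} {m : ℝ → ℝ} {g : ℝ → ℝ≥0∞}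

/-- The barrier jumps from 0 to 1 at time 0 and is constant afterwards, so its Caputo derivative is
the jump term alone. -/
theorem ofReal_le_iSup_div_barrierR₀ (hα : α ∈ Ioo (0 : ℝ) 1) (hlam : 0 ≤ lam)
    (hmc : ContinuousOn m (Icc 0 T)) (hm0 : m 0 = 0)
    (hmL : ∀ ε > 0, ∃ K : ℝ≥0, LipschitzOnWith K m (Icc ε T))
    (h : ∀ t ∈ Ioc 0 T, ENNReal.ofReal (caputo α m t + lam * m t) ≤ g t) :
    ∀ t ∈ Ioc 0 T, ENNReal.ofReal (m t) ≤
      ⨆ s ∈ Ioc 0 t, g s / ENNReal.ofReal (barrierR₀ α lam s) := by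
  intro t ht
  have hone : ∀ s, HasCaputo α (fun _ => (1 : ℝ)) s := fun s =>
    hasCaputo_of_abs_sub_le (C := 0) hα.2 continuousOn_const (by simp)
  have h1 := ofReal_le_mul_iSup_div hα hlam hmc hm0 hmL h
    (B := fun s => if s ≤ 0 then 0 else 1) (r := barrierR₀ α lam)
    (continuousOn_ite continuousOn_const) (by simp) (fun s hs => by simp [not_le.2 hs])
    (fun s hs => hasCaputo_ite hs (hone s)) (fun s hs => barrierR₀_pos hα hlam hs)
    (fun s hs => by
      rw [caputo_ite_eq α hs fun _ => 1, barrierR₀]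
      simp [caputo, caputoIntegrand, not_le.2 hs]) t ht
  simpa [not_le.2 ht.1] using h1

theorem ofReal_le_barrierE₁_mul_iSup_div (hα : α ∈ Ioo (0 : ℝ) 1) (hlam : 0 ≤ lam)
    (hmc : ContinuousOn m (Icc 0 T)) (hm0 : m 0 = 0)
    (hmL : ∀ ε > 0, ∃ K : ℝ≥0, LipschitzOnWith K m (Icc ε T))
    (h : ∀ t ∈ Ioc 0 T, ENNReal.ofReal (caputo α m t + lam * m t) ≤ g t) {τ : ℝ} (hτ : 0 < τ) :
    ∀ t ∈ Ioc 0 T, ENNReal.ofReal (m t) ≤ ENNReal.ofReal (barrierE₁ α τ t) *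
      ⨆ s ∈ Ioc 0 t, g s / ENNReal.ofReal (barrierR₁ α lam τ s) := by
  intro t ht
  obtain ⟨K, hK⟩ := exists_lipschitzWith_barrierE₁ hα hτ
  have h1 := ofReal_le_mul_iSup_div hα hlam hmc hm0 hmL h
    (B := fun s => if s ≤ 0 then 0 else barrierE₁ α τ s) (r := barrierR₁ α lam τ)
    (continuousOn_ite hK.continuous.continuousOn) (by simp)
    (fun s hs => by simpa [not_le.2 hs] using barrierE₁_pos hτ)
    (fun s hs => hasCaputo_ite hs (hasCaputo_of_lipschitzOnWith hα.2 hK.lipschitzOnWith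
      (⟨hs, le_rfl⟩ : s ∈ Ioc 0 s))) (fun s hs => barrierR₁_pos hα hlam hτ hs)
    (fun s hs => by
      rw [caputo_ite_eq α hs, caputo_barrierE₁ hα hτ hs, barrierR₁]
      simp [not_le.2 hs]) t ht
  simpa [not_le.2 ht.1] using h1

end Scalar

/-! ### From a bounded weak derivative to a Lipschitz bound -/

section WeakDerivative

open scoped Convolution

/-- The difference of two translates of the primitive of a normalized bump function: a smoothed
indicator function of `[s, t]`. -/
theorem exists_smoothed_indicator (η : ContDiffBump (0 : ℝ)) {s t : ℝ} (hst : s ≤ t) :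
    ∃ φ : ℝ → ℝ, ContDiff ℝ ∞ φ ∧ (∀ r, 0 ≤ φ r ∧ φ r ≤ 1) ∧
      (∀ r ∉ Icc (s - η.rOut) (t + η.rOut), φ r = 0) ∧
      ∀ r, deriv φ r = η.normed volume (r - s) - η.normed volume (r - t) := by
  set p := η.normed (volume : Measure ℝ) with hp
  have hpc : Continuous p := η.continuous_normed
  have hp0 : ∀ q, 0 ≤ p q := η.nonneg_normed
  have hpz : ∀ q, η.rOut ≤ |q| → p q = 0 := fun q hq => by
    have : q ∉ Function.support p := by
      rw [hp, η.support_normed_eq, Metric.mem_ball, Real.dist_eq, sub_zero]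
      exact not_lt.2 hq
    simpa using this
  set P : ℝ → ℝ := fun x => ∫ q in (0)..x, p q with hP
  have hPd : ∀ x, HasDerivAt P (p x) x := fun x =>
    intervalIntegral.integral_hasDerivAt_right (hpc.intervalIntegrable _ _)
      (hpc.stronglyMeasurableAtFilter _ _) hpc.continuousAt
  have hPs : ContDiff ℝ ∞ P := by
    rw [contDiff_infty_iff_deriv]
    refine ⟨fun x => (hPd x).differentiableAt, ?_⟩
    rw [show deriv P = p from funext fun x => (hPd x).deriv]
    exact η.contDiff_normed
  have hφ : ∀ r, P (r - s) - P (r - t) = ∫ q in (r - t)..(r - s), p q := fun r =>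
    intervalIntegral.integral_interval_sub_left (hpc.intervalIntegrable _ _)
      (hpc.intervalIntegrable _ _)
  have hle : ∀ r, r - t ≤ r - s := fun r => by linarith
  refine ⟨fun r => P (r - s) - P (r - t), ?_, fun r => ⟨?_, ?_⟩, fun r hr => ?_, fun r => ?_⟩
  · exact (hPs.comp (contDiff_id.sub contDiff_const)).sub
      (hPs.comp (contDiff_id.sub contDiff_const))
  · beta_reduce
    rw [hφ]
    exact intervalIntegral.integral_nonneg (hle r) fun q _ => hp0 q
  · beta_reduce
    rw [hφ, intervalIntegral.integral_of_le (hle r), ← η.integral_normed (μ := volume)]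
    exact setIntegral_le_integral η.integrable_normed (Eventually.of_forall hp0)
  · beta_reduce
    rw [hφ]
    refine intervalIntegral.integral_zero_ae (Eventually.of_forall fun q hq => hpz q ?_)
    rw [uIoc_of_le (hle r)] at hq
    rw [mem_Icc, not_and_or, not_le, not_le] at hr
    rcases hr with hr | hr
    · exact le_abs.2 (Or.inr (by linarith [hq.2]))
    · exact le_abs.2 (Or.inl (by linarith [hq.1]))
  · exact (((hPd (r - s)).comp_sub_const r s).sub ((hPd (r - t)).comp_sub_const r t)).deriv

/-- A continuous function with an essentially bounded weak derivative is Lipschitz. -/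
theorem abs_sub_le_of_weak_deriv {a b K : ℝ} {g h : ℝ → ℝ} (hg : ContinuousOn g (Ioo a b))
    (hgi : IntegrableOn g (Ioo a b)) (hK : ∀ᵐ r ∂volume.restrict (Ioo a b), |h r| ≤ K)
    (hw : ∀ φ : ℝ → ℝ, ContDiff ℝ ∞ φ → HasCompactSupport φ → tsupport φ ⊆ Ioo a b →
      ∫ r in Ioo a b, deriv φ r * g r = -∫ r in Ioo a b, φ r * h r)
    {s t : ℝ} (hs : s ∈ Ioo a b) (ht : t ∈ Ioo a b) (hst : s ≤ t) :
    |g t - g s| ≤ K * (t - s) := by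
  -- Testing with the smoothed indicator of [s, t] compares averages of `g` near s and t. The 2δ is
  -- the overshoot of the test function's support, and the 2ε is the cost of replacing the two
  -- averages by point values.
  have key : ∀ ε > 0, ∃ δ₀ > 0, ∀ δ ∈ Ioo 0 δ₀, |g t - g s| ≤ K * (t - s + 2 * δ) + 2 * ε := by
    intro ε hε
    have hnear : ∀ x ∈ Ioo a b, ∀ᶠ r in 𝓝 x, dist (g r) (g x) ≤ ε ∧ r ∈ Ioo a b := fun x hx =>
      ((hg.continuousAt (Ioo_mem_nhds hx.1 hx.2)).eventually
        (Metric.closedBall_mem_nhds (g x) hε)).and (Ioo_mem_nhds hx.1 hx.2)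
    obtain ⟨δ₁, hδ₁, h₁⟩ := Metric.eventually_nhds_iff.1 (hnear s hs)
    obtain ⟨δ₂, hδ₂, h₂⟩ := Metric.eventually_nhds_iff.1 (hnear t ht)
    refine ⟨min δ₁ δ₂, lt_min hδ₁ hδ₂, fun δ hδ => ?_⟩
    have hd1 : δ < δ₁ := hδ.2.trans_le (min_le_left _ _)
    have hd2 : δ < δ₂ := hδ.2.trans_le (min_le_right _ _)
    let η : ContDiffBump (0 : ℝ) := ⟨δ / 2, δ, by linarith [hδ.1], by linarith [hδ.1]⟩
    obtain ⟨φ, hφs, hφ01, hφz, hφd⟩ := exists_smoothed_indicator η hst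
    have hsub : Icc (s - η.rOut) (t + η.rOut) ⊆ Ioo a b := fun r hr => by
      have e1 : s - δ ∈ Ioo a b := (h₁ (by
        rw [Real.dist_eq, sub_sub_cancel_left, abs_neg, abs_of_pos hδ.1]; exact hd1)).2
      have e2 : t + δ ∈ Ioo a b := (h₂ (by
        rw [Real.dist_eq, add_sub_cancel_left, abs_of_pos hδ.1]; exact hd2)).2
      exact ⟨e1.1.trans_le hr.1, hr.2.trans_lt e2.2⟩
    have hts : tsupport φ ⊆ Icc (s - η.rOut) (t + η.rOut) :=
      closure_minimal (fun r hr => by by_contra h'; exact hr (hφz r h')) isClosed_Icc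
    have hcs : HasCompactSupport φ := HasCompactSupport.of_support_subset_isCompact isCompact_Icc
      (subset_closure.trans hts)
    have hmain := hw φ hφs hcs (hts.trans hsub)
    have hav : ∀ x ∈ Ioo a b, (∀ r ∈ Metric.ball x δ, dist (g r) (g x) ≤ ε ∧ r ∈ Ioo a b) →
        IntegrableOn (fun r => η.normed volume (r - x) * g r) (Ioo a b) ∧
        |(∫ r in Ioo a b, η.normed volume (r - x) * g r) - g x| ≤ ε := by
      intro x hx hball
      constructor
      · obtain ⟨C, hC⟩ := (η.continuous_normed (μ := volume)).bounded_above_of_compact_support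
          η.hasCompactSupport_normed
        exact Integrable.bdd_mul (c := C) hgi
          ((η.continuous_normed (μ := volume)).comp (continuous_sub_right x)).aestronglyMeasurable
          (Eventually.of_forall fun r => hC _)
      · have hm : AEStronglyMeasurable ((Ioo a b).indicator g) volume :=
          ((integrable_indicator_iff measurableSet_Ioo).2 hgi).aestronglyMeasurable
        have hx' : (Ioo a b).indicator g x = g x := indicator_of_mem hx g
        have h3 := η.dist_normed_convolution_le (μ := volume) (x₀ := x) (ε := ε) hm fun r hr => by
          rw [hx', indicator_of_mem (hball r hr).2]; exact (hball r hr).1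
        rw [hx', Real.dist_eq, convolution_lsmul_swap] at h3
        convert h3 using 3
        rw [← integral_indicator measurableSet_Ioo]
        refine integral_congr_ae (Eventually.of_forall fun r => ?_)
        have hneg : η.normed volume (r - x) = η.normed volume (x - r) := by
          rw [← neg_sub x r, η.normed_neg]
        by_cases hr : r ∈ Ioo a b
        · simp [hr, hneg]
        · simp [hr]
    obtain ⟨i1, b1⟩ := hav s hs fun r hr => h₁ (lt_trans hr hd1)
    obtain ⟨i2, b2⟩ := hav t ht fun r hr => h₂ (lt_trans hr hd2)
    have h4 : ∫ r in Ioo a b, deriv φ r * g r =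
        (∫ r in Ioo a b, η.normed volume (r - s) * g r) -
          ∫ r in Ioo a b, η.normed volume (r - t) * g r := by
      rw [← integral_sub i1 i2]
      exact integral_congr_ae (Eventually.of_forall fun r => by simp only [hφd]; ring)
    have h5 : |∫ r in Ioo a b, φ r * h r| ≤ K * (t - s + 2 * δ) := by
      rw [setIntegral_eq_of_subset_of_forall_sdiff_eq_zero measurableSet_Ioo hsub
        fun r hr => by rw [hφz r hr.2, zero_mul]]
      have := norm_setIntegral_le_of_norm_le_const_ae (μ := volume) (C := K)
        (s := Icc (s - η.rOut) (t + η.rOut)) (f := fun r => φ r * h r) measure_Icc_lt_top (by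
          filter_upwards [ae_restrict_of_ae_restrict_of_subset hsub hK] with r hr
          rw [norm_mul, Real.norm_eq_abs, Real.norm_eq_abs, abs_of_nonneg (hφ01 r).1]
          exact (mul_le_of_le_one_left (abs_nonneg _) (hφ01 r).2).trans hr)
      rw [Real.norm_eq_abs, Measure.real, Real.volume_Icc, ENNReal.toReal_ofReal
        (by show 0 ≤ t + δ - (s - δ); linarith [hδ.1])] at this
      refine this.trans (le_of_eq ?_)
      show K * (t + δ - (s - δ)) = _
      ring
    rw [h4] at hmain
    have h6 := abs_le.1 b1
    have h7 := abs_le.1 b2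
    have h8 := abs_le.1 h5
    rw [abs_le]
    constructor <;> linarith [h6.1, h6.2, h7.1, h7.2, h8.1, h8.2]
  refine le_of_forall_pos_le_add fun ε hε => ?_
  obtain ⟨δ₀, hδ₀, hδ⟩ := key (ε / 2) (by linarith)
  have hlim : Tendsto (fun δ : ℝ => K * (t - s + 2 * δ) + ε) (𝓝[>] 0)
      (𝓝 (K * (t - s) + ε)) := by
    have : Continuous fun δ : ℝ => K * (t - s + 2 * δ) + ε := by fun_prop
    have := this.tendsto 0
    rw [mul_zero, add_zero] at this
    exact this.mono_left nhdsWithin_le_nhds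
  refine ge_of_tendsto hlim ?_
  filter_upwards [Ioo_mem_nhdsGT hδ₀] with δ h'
  exact (hδ δ h').trans_eq (by ring)

end WeakDerivative

/-! ### Lipschitz continuity in time, uniform in space -/

section TimeRegularity

variable {d : ℕ} {Ω : Set (EuclideanSpace ℝ (Fin d))} {T : ℝ}
  {v : EuclideanSpace ℝ (Fin d) → ℝ → ℝ}

theorem abs_le_norm_Lp_top {β : Type*} [MeasurableSpace β] {μ : Measure β} (f : Lp ℝ ∞ μ) :
    ∀ᵐ x ∂μ, ‖f x‖ ≤ ‖f‖ := by
  have h := ae_le_eLpNormEssSup (f := f) (μ := μ)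
  have hfin : eLpNorm f ∞ μ ≠ ⊤ := Lp.eLpNorm_ne_top f
  filter_upwards [h] with x hx
  rw [← eLpNorm_exponent_top] at hx
  rw [Lp.norm_def, ← toReal_enorm]
  exact ENNReal.toReal_mono hfin hx

/-- Integration over a set of finite measure, as a functional on `L_∞`. -/
theorem exists_setIntegral_clm {β : Type*} [MeasurableSpace β] {μ : Measure β} {B : Set β}
    (hB : μ B ≠ ⊤) : ∃ L : Lp ℝ ∞ μ →L[ℝ] ℝ,
      (∀ f, L f = ∫ x in B, f x ∂μ) ∧ ∀ f, |L f| ≤ μ.real B * ‖f‖ := by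
  have hi : ∀ f : Lp ℝ ∞ μ, IntegrableOn f B μ := fun f =>
    Measure.integrableOn_of_bounded (M := ‖f‖) hB (Lp.aestronglyMeasurable f)
      (ae_restrict_of_ae (abs_le_norm_Lp_top f))
  let L₀ : Lp ℝ ∞ μ →ₗ[ℝ] ℝ :=
    { toFun := fun f => ∫ x in B, f x ∂μ
      map_add' := fun f g => by
        rw [← integral_add (hi f) (hi g)]
        exact integral_congr_ae (ae_restrict_of_ae (Lp.coeFn_add f g))
      map_smul' := fun c f => by
        rw [RingHom.id_apply, ← integral_smul]
        exact integral_congr_ae (ae_restrict_of_ae (Lp.coeFn_smul c f)) }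
  have hb : ∀ f, ‖L₀ f‖ ≤ μ.real B * ‖f‖ := fun f => by
    rw [mul_comm]
    exact norm_setIntegral_le_of_norm_le_const_ae hB.lt_top
      (ae_restrict_of_ae (abs_le_norm_Lp_top f))
  exact ⟨L₀.mkContinuous _ hb, fun f => rfl, hb⟩

/-- `V` agrees with `v` only almost everywhere, so point values are reached through integrals over
small balls B. Integration over B maps the weak derivative `G` to a scalar weak derivative bounded
by |B| K, and by continuity a violation at one point would persist on a small ball. -/
theorem MemW1Inf.exists_lipschitz {t₁ t₂ : ℝ} (hΩ : IsOpen Ω) (hΩb : Bornology.IsBounded Ω)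
    (hv : ContinuousOn (fun p : EuclideanSpace ℝ (Fin d) × ℝ => v p.1 p.2)
      (closure Ω ×ˢ Icc 0 T)) (ht₁ : 0 ≤ t₁) (ht₂ : t₂ ≤ T) (h : MemW1Inf Ω t₁ t₂ v) :
    ∃ K : ℝ, 0 ≤ K ∧ ∀ x ∈ Ω, ∀ s ∈ Ioo t₁ t₂, ∀ t ∈ Ioo t₁ t₂, s ≤ t →
      |v x t - v x s| ≤ K * (t - s) := by
  obtain ⟨V, G, hVv, hV, hG, hweak⟩ := h
  set K := (eLpNorm G ∞ (volume.restrict (Ioo t₁ t₂))).toReal with hKdef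
  have hK0 : 0 ≤ K := ENNReal.toReal_nonneg
  have hGK : ∀ᵐ t ∂volume.restrict (Ioo t₁ t₂), ‖G t‖ ≤ K := by
    filter_upwards [ae_le_eLpNormEssSup (f := G) (μ := volume.restrict (Ioo t₁ t₂))] with t ht
    rw [← eLpNorm_exponent_top] at ht
    rw [← toReal_enorm]
    exact ENNReal.toReal_mono hG.eLpNorm_ne_top ht
  obtain ⟨M, hM⟩ := (hΩb.isCompact_closure.prod isCompact_Icc).exists_bound_of_continuousOn hv
  have hIoo : Ioo t₁ t₂ ⊆ Icc 0 T := fun r hr => ⟨ht₁.trans hr.1.le, hr.2.le.trans ht₂⟩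
  refine ⟨K, hK0, fun x hx s hs t ht hst => ?_⟩
  by_contra! hlt
  set c := v x t - v x s with hc
  -- Half the supposed excess: averaging over B gives |c| ≤ K(t-s) + ε, which is then impossible.
  set ε := (|c| - K * (t - s)) / 2 with hε
  have hε0 : 0 < ε := by linarith
  have hcx : ∀ r ∈ Ioo t₁ t₂, ContinuousOn (fun y => v y r) Ω := fun r hr =>
    hv.comp (f := fun y => (y, r)) (by fun_prop) fun y hy => ⟨subset_closure hy, hIoo hr⟩
  have hct : ∀ y ∈ Ω, ContinuousOn (v y) (Ioo t₁ t₂) := fun y hy =>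
    hv.comp (f := fun r => (y, r)) (by fun_prop) fun r hr => ⟨subset_closure hy, hIoo hr⟩
  have hev : ∀ᶠ y in 𝓝 x, dist (v y t - v y s) c ≤ ε ∧ y ∈ Ω :=
    ((((hcx t ht).sub (hcx s hs)).continuousAt (hΩ.mem_nhds hx)).eventually
      (Metric.closedBall_mem_nhds _ hε0)).and (hΩ.mem_nhds hx)
  obtain ⟨ρ, hρ, hball⟩ := Metric.eventually_nhds_iff_ball.1 hev
  set B := Metric.ball x ρ with hB
  have hBΩ : B ⊆ Ω := fun y hy => (hball y hy).2
  have hBfin : volume B < ⊤ := measure_ball_lt_top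
  have hBpos : 0 < volume.real B :=
    ENNReal.toReal_pos (Metric.measure_ball_pos volume x hρ).ne' hBfin.ne
  have hBm : MeasurableSet B := measurableSet_ball
  have hres : (volume.restrict Ω).restrict B = volume.restrict B := by
    rw [Measure.restrict_restrict hBm, inter_eq_self_of_subset_left hBΩ]
  have hreal : (volume.restrict Ω).real B = volume.real B := by
    rw [Measure.real, Measure.restrict_apply hBm, inter_eq_self_of_subset_left hBΩ, Measure.real]
  obtain ⟨L, hL, hLb⟩ := exists_setIntegral_clm (μ := volume.restrict Ω) (B := B)
    (by rw [Measure.restrict_apply hBm, inter_eq_self_of_subset_left hBΩ]; exact hBfin.ne)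
  set g : ℝ → ℝ := fun r => ∫ y in B, v y r with hg
  have hvm : ∀ r ∈ Ioo t₁ t₂, AEStronglyMeasurable (fun y => v y r) (volume.restrict B) :=
    fun r hr => ((hcx r hr).mono hBΩ).aestronglyMeasurable hBm
  have hvM : ∀ r ∈ Ioo t₁ t₂, ∀ᵐ y ∂volume.restrict B, ‖v y r‖ ≤ M := fun r hr =>
    (ae_restrict_iff' hBm).2 (Eventually.of_forall fun y hy =>
      hM (y, r) ⟨subset_closure (hBΩ hy), hIoo hr⟩)
  have hMi : IntegrableOn (fun _ : EuclideanSpace ℝ (Fin d) => M) B :=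
    integrableOn_const hBfin.ne
  have hvi : ∀ r ∈ Ioo t₁ t₂, IntegrableOn (fun y => v y r) B := fun r hr =>
    Integrable.mono' hMi (hvm r hr) (hvM r hr)
  have hgc : ContinuousOn g (Ioo t₁ t₂) :=
    continuousOn_of_dominated (bound := fun _ => M) hvm hvM hMi
      ((ae_restrict_iff' hBm).2 (Eventually.of_forall fun y hy => hct y (hBΩ hy)))
  have hgi : IntegrableOn g (Ioo t₁ t₂) := by
    refine Integrable.mono' (integrableOn_const (C := M * volume.real B) measure_Ioo_lt_top.ne)
      (hgc.aestronglyMeasurable measurableSet_Ioo) ?_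
    exact (ae_restrict_iff' measurableSet_Ioo).2 (Eventually.of_forall fun r hr =>
      norm_setIntegral_le_of_norm_le_const_ae hBfin (hvM r hr))
  have hLV : ∀ᵐ r ∂volume.restrict (Ioo t₁ t₂), L (V r) = g r := by
    filter_upwards [hVv] with r hr
    rw [hL, hres, hg]
    refine integral_congr_ae ?_
    rw [← hres]
    exact ae_restrict_of_ae hr
  have hLG : ∀ᵐ r ∂volume.restrict (Ioo t₁ t₂), |L (G r)| ≤ volume.real B * K := by
    filter_upwards [hGK] with r hr
    refine (hLb _).trans ?_
    rw [hreal]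
    gcongr
  have hVi : Integrable V (volume.restrict (Ioo t₁ t₂)) := hV.integrable le_top
  have hGi : Integrable G (volume.restrict (Ioo t₁ t₂)) := hG.integrable le_top
  have hlip := abs_sub_le_of_weak_deriv (h := fun r => L (G r)) hgc hgi hLG
    (fun φ hφ hφc hφs => by
      have hw := congrArg L (hweak φ hφ hφc hφs)
      obtain ⟨C₁, hC₁⟩ := (hφ.continuous_deriv (by simp)).bounded_above_of_compact_support hφc.deriv
      obtain ⟨C₂, hC₂⟩ := hφ.continuous.bounded_above_of_compact_support hφc
      have i1 : Integrable (fun r => deriv φ r • V r) (volume.restrict (Ioo t₁ t₂)) :=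
        hVi.bdd_smul C₁ (hφ.continuous_deriv (by simp)).aestronglyMeasurable
          (Eventually.of_forall hC₁)
      have i2 : Integrable (fun r => φ r • G r) (volume.restrict (Ioo t₁ t₂)) :=
        hGi.bdd_smul C₂ hφ.continuous.aestronglyMeasurable (Eventually.of_forall hC₂)
      rw [map_neg, ← L.integral_comp_comm i1, ← L.integral_comp_comm i2] at hw
      simp only [map_smul, smul_eq_mul] at hw
      rw [← hw]
      refine integral_congr_ae ?_
      filter_upwards [hLV] with r hr
      rw [hr]) hs ht hst
  have hsub : g t - g s = ∫ y in B, (v y t - v y s) := (integral_sub (hvi t ht) (hvi s hs)).symm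
  have hdiff : |g t - g s - volume.real B * c| ≤ ε * volume.real B := by
    have h1 : volume.real B * c = ∫ _ in B, c := by rw [setIntegral_const, smul_eq_mul]
    rw [hsub, h1, ← integral_sub (f := fun y => v y t - v y s)
      ((hvi t ht).sub (hvi s hs)) (integrableOn_const hBfin.ne)]
    exact norm_setIntegral_le_of_norm_le_const (f := fun y => v y t - v y s - c) hBfin
      fun y hy => (hball y hy).1
  have h2 : volume.real B * |c| ≤ volume.real B * (K * (t - s) + ε) := by
    have h3 : |volume.real B * c| ≤ |g t - g s| + |g t - g s - volume.real B * c| := by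
      have := abs_sub (g t - g s) (g t - g s - volume.real B * c)
      rwa [sub_sub_cancel] at this
    rw [abs_mul, abs_of_pos hBpos] at h3
    nlinarith
  have h4 := le_of_mul_le_mul_left h2 hBpos
  linarith

theorem Regular.exists_lipschitzOnWith (hΩ : IsOpen Ω) (hΩb : Bornology.IsBounded Ω)
    (hv : Regular Ω T v) {ε : ℝ} (hε : 0 < ε) :
    ∃ K : ℝ≥0, ∀ x ∈ Ω, LipschitzOnWith K (v x) (Icc ε T) := by
  rcases le_or_gt T ε with hT | hT
  · refine ⟨0, fun x _ => LipschitzOnWith.of_dist_le_mul fun s hs t ht => ?_⟩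
    have : s = t := by linarith [hs.1, hs.2, ht.1, ht.2]
    simp [this]
  -- Starting at ε/2 is harmless: the bound on the open interval extends by continuity to its
  -- closure, which contains [ε, T].
  obtain ⟨K, hK0, hK⟩ := (hv.memW1Inf (ε / 2) T (by linarith) (by linarith) le_rfl).exists_lipschitz
    hΩ hΩb hv.continuousOn (by linarith) le_rfl
  refine ⟨K.toNNReal, fun x hx => ?_⟩
  have h1 : LipschitzOnWith K.toNNReal (v x) (Ioo (ε / 2) T) := by
    refine LipschitzOnWith.of_dist_le_mul fun s hs t ht => ?_
    rw [Real.coe_toNNReal _ hK0, Real.dist_eq, Real.dist_eq]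
    rcases le_total s t with h | h
    · rw [abs_sub_comm, abs_sub_comm s, abs_of_nonneg (sub_nonneg.2 h)]
      exact hK x hx s hs t ht h
    · rw [abs_of_nonneg (sub_nonneg.2 h)]
      exact hK x hx t ht s hs h
  have hcl : closure (Ioo (ε / 2) T) = Icc (ε / 2) T := closure_Ioo (by linarith)
  have hcont : ContinuousOn (v x) (Icc (ε / 2) T) :=
    hv.continuousOn.comp (f := fun r => (x, r)) (by fun_prop) fun r hr =>
      ⟨subset_closure hx, (half_pos hε).le.trans hr.1, hr.2⟩
  have h2 := h1.closure (by rwa [hcl])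
  rw [hcl] at h2
  exact h2.mono (Icc_subset_Icc_left (by linarith))

end TimeRegularity

/-! ### The spatial operator and its sign at a maximum -/

section SpatialOperator

variable {d : ℕ} {Ω : Set (EuclideanSpace ℝ (Fin d))}
  {a b : Fin d → EuclideanSpace ℝ (Fin d) → ℝ} {c : EuclideanSpace ℝ (Fin d) → ℝ}
  {v w : EuclideanSpace ℝ (Fin d) → ℝ}

theorem partialDeriv_eq_fderiv {k : Fin d} {x : EuclideanSpace ℝ (Fin d)}
    (hv : DifferentiableAt ℝ v x) :
    partialDeriv k v x = fderiv ℝ v x (EuclideanSpace.single k 1) :=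
  hv.lineDeriv_eq_fderiv

theorem contDiffOn_partialDeriv (hΩ : IsOpen Ω) (hv : ContDiffOn ℝ 2 v Ω) (k : Fin d) :
    ContDiffOn ℝ 1 (partialDeriv k v) Ω := by
  have h := (hv.fderiv_of_isOpen hΩ (m := 1) (by norm_num)).clm_apply
    (contDiffOn_const (c := EuclideanSpace.single k (1 : ℝ)))
  exact h.congr fun x hx => partialDeriv_eq_fderiv
    ((hv.contDiffAt (hΩ.mem_nhds hx)).differentiableAt (by norm_num))

theorem continuousOn_partialDeriv (hΩ : IsOpen Ω) (hv : ContDiffOn ℝ 1 v Ω) (k : Fin d) :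
    ContinuousOn (partialDeriv k v) Ω := by
  have h := (hv.continuousOn_fderiv_of_isOpen hΩ le_rfl).clm_apply
    (continuousOn_const (c := EuclideanSpace.single k (1 : ℝ)))
  exact h.congr fun x hx => partialDeriv_eq_fderiv
    ((hv.contDiffAt (hΩ.mem_nhds hx)).differentiableAt one_ne_zero)

theorem partialDeriv_sub {k : Fin d} {x : EuclideanSpace ℝ (Fin d)}
    (hv : DifferentiableAt ℝ v x) (hw : DifferentiableAt ℝ w x) :
    partialDeriv k (fun y => v y - w y) x = partialDeriv k v x - partialDeriv k w x := by
  rw [partialDeriv_eq_fderiv hv, partialDeriv_eq_fderiv hw, partialDeriv_eq_fderiv (hv.fun_sub hw),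
    fderiv_fun_sub hv hw, sub_apply]

theorem partialDeriv_const_mul (k : Fin d) (m : ℝ) (v : EuclideanSpace ℝ (Fin d) → ℝ) :
    partialDeriv k (fun y => m * v y) = fun x => m * partialDeriv k v x :=
  funext fun _ => deriv_const_mul_field m

theorem partialDeriv_congr {k : Fin d} {x : EuclideanSpace ℝ (Fin d)} (h : v =ᶠ[𝓝 x] w) :
    partialDeriv k v x = partialDeriv k w x :=
  h.lineDeriv_eq

theorem spatialOp_const_mul (m : ℝ) (v : EuclideanSpace ℝ (Fin d) → ℝ)
    (x : EuclideanSpace ℝ (Fin d)) :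
    spatialOp a b c (fun y => m * v y) x = m * spatialOp a b c v x := by
  simp only [spatialOp, partialDeriv_const_mul, mul_add, Finset.mul_sum]
  congr 1
  · exact Finset.sum_congr rfl fun k _ => by ring
  · ring

theorem spatialOp_sub (hΩ : IsOpen Ω) (hv : ContDiffOn ℝ 2 v Ω) (hw : ContDiffOn ℝ 2 w Ω)
    {x : EuclideanSpace ℝ (Fin d)} (hx : x ∈ Ω) :
    spatialOp a b c (fun y => v y - w y) x = spatialOp a b c v x - spatialOp a b c w x := by
  have hd : ∀ {v : EuclideanSpace ℝ (Fin d) → ℝ}, ContDiffOn ℝ 2 v Ω → ∀ y ∈ Ω,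
      DifferentiableAt ℝ v y := fun h y hy =>
    (h.contDiffAt (hΩ.mem_nhds hy)).differentiableAt (by norm_num)
  have hd' : ∀ {v : EuclideanSpace ℝ (Fin d) → ℝ}, ContDiffOn ℝ 2 v Ω → ∀ k,
      DifferentiableAt ℝ (partialDeriv k v) x := fun h k =>
    ((contDiffOn_partialDeriv hΩ h k).contDiffAt (hΩ.mem_nhds hx)).differentiableAt one_ne_zero
  have h1 : ∀ k, ∀ y ∈ Ω, partialDeriv k (fun y => v y - w y) y =
      partialDeriv k v y - partialDeriv k w y := fun k y hy =>
    partialDeriv_sub (hd hv y hy) (hd hw y hy)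
  have h2 : ∀ k, partialDeriv k (partialDeriv k fun y => v y - w y) x =
      partialDeriv k (partialDeriv k v) x - partialDeriv k (partialDeriv k w) x := fun k => by
    rw [← partialDeriv_sub (hd' hv k) (hd' hw k)]
    exact partialDeriv_congr (Filter.eventually_of_mem (hΩ.mem_nhds hx) (h1 k))
  simp only [spatialOp, h1 _ x hx, h2]
  rw [add_sub_add_comm, ← Finset.sum_sub_distrib, mul_sub]
  congr 1
  exact Finset.sum_congr rfl fun k _ => by ring

theorem continuousOn_spatialOp (hΩ : IsOpen Ω) (ha : ∀ k, ContinuousOn (a k) Ω)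
    (hb : ∀ k, ContinuousOn (b k) Ω) (hc : ContinuousOn c Ω) (hv : ContDiffOn ℝ 2 v Ω) :
    ContinuousOn (spatialOp a b c v) Ω := by
  refine ContinuousOn.add (continuousOn_finsetSum _ fun k _ => ?_) (hc.mul hv.continuousOn)
  exact ((ha k).neg.mul (continuousOn_partialDeriv hΩ (contDiffOn_partialDeriv hΩ hv k) k)).add
    ((hb k).mul (continuousOn_partialDeriv hΩ (hv.of_le (by norm_num)) k))

/-- A positive second derivative would make x a local minimum as well, hence f locally constant,
contradicting positivity. -/
theorem deriv_deriv_nonpos_of_isLocalMax {f : ℝ → ℝ} {x : ℝ} (hf : ContinuousAt f x)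
    (h : IsLocalMax f x) : deriv (deriv f) x ≤ 0 := by
  by_contra! hpos
  have hmin := isLocalMin_of_deriv_deriv_pos hpos h.deriv_eq_zero hf
  have hconst : f =ᶠ[𝓝 x] fun _ => f x := by
    filter_upwards [h, hmin] with y h1 h2 using le_antisymm h1 h2
  have h0 : deriv f =ᶠ[𝓝 x] fun _ => 0 := by
    filter_upwards [hconst.deriv] with y hy
    rw [hy, deriv_const]
  rw [h0.deriv_eq, deriv_const] at hpos
  exact lt_irrefl _ hpos

theorem partialDeriv_of_isLocalMax {k : Fin d} {x : EuclideanSpace ℝ (Fin d)}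
    (hv : ContinuousAt v x) (h : IsLocalMax v x) :
    partialDeriv k v x = 0 ∧ partialDeriv k (partialDeriv k v) x ≤ 0 := by
  set φ : ℝ → ℝ := fun s => v (x + s • EuclideanSpace.single k 1) with hφ
  have hline : Continuous fun s : ℝ => x + s • (EuclideanSpace.single k (1 : ℝ)) := by fun_prop
  have h0 : x + (0 : ℝ) • (EuclideanSpace.single k (1 : ℝ)) = x := by rw [zero_smul, add_zero]
  have hlt := hline.tendsto 0
  rw [h0] at hlt
  have hφmax : IsLocalMax φ 0 := by
    have := hlt.eventually h
    filter_upwards [this] with s hs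
    simpa [hφ, h0] using hs
  have hφc : ContinuousAt φ 0 :=
    ContinuousAt.comp (g := v) (by rwa [h0]) hline.continuousAt
  have hd : ∀ s, partialDeriv k v (x + s • EuclideanSpace.single k 1) = deriv φ s := fun s => by
    have := deriv_comp_const_add (f := φ) s 0
    rw [add_zero] at this
    rw [← this, partialDeriv, lineDeriv]
    simp only [hφ, add_smul, add_assoc]
  constructor
  · have := hd 0
    rw [h0] at this
    rw [this, hφmax.deriv_eq_zero]
  · have : partialDeriv k (partialDeriv k v) x = deriv (deriv φ) 0 := by
      rw [partialDeriv, lineDeriv]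
      simp only [hd]
    rw [this]
    exact deriv_deriv_nonpos_of_isLocalMax hφc hφmax

/-- There are no mixed derivatives in 𝓛, so the one-dimensional test along each coordinate axis
suffices. -/
theorem le_spatialOp_of_isLocalMax {x : EuclideanSpace ℝ (Fin d)} (ha : ∀ k, 0 < a k x)
    (hv : ContinuousAt v x) (h : IsLocalMax v x) : c x * v x ≤ spatialOp a b c v x := by
  rw [spatialOp]
  refine le_add_of_nonneg_left (Finset.sum_nonneg fun k _ => ?_)
  obtain ⟨h1, h2⟩ := partialDeriv_of_isLocalMax (k := k) hv h
  rw [h1, mul_zero, add_zero]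
  exact mul_nonneg_of_nonpos_of_nonpos (neg_nonpos.2 (ha k).le) h2

end SpatialOperator

/-! ### Point values and the essential supremum -/

section Norm

variable {d : ℕ} {Ω : Set (EuclideanSpace ℝ (Fin d))} {v : EuclideanSpace ℝ (Fin d) → ℝ}

/-- A superlevel set of a continuous function in Ω is open, so it has positive measure as soon as it
is nonempty. -/
theorem enorm_le_normLinf (hΩ : IsOpen Ω) (hv : ContinuousOn v Ω)
    {x : EuclideanSpace ℝ (Fin d)} (hx : x ∈ Ω) : ‖v x‖ₑ ≤ normLinf Ω v := by
  by_contra! hlt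
  have hopen : IsOpen (Ω ∩ (fun y => ‖v y‖ₑ) ⁻¹' Ioi (normLinf Ω v)) :=
    hv.enorm.isOpen_inter_preimage hΩ isOpen_Ioi
  have hnull := ae_le_eLpNormEssSup (f := v) (μ := volume.restrict Ω)
  rw [ae_restrict_iff' hΩ.measurableSet, ae_iff] at hnull
  have hsub : Ω ∩ (fun y => ‖v y‖ₑ) ⁻¹' Ioi (normLinf Ω v) ⊆
      {y | ¬(y ∈ Ω → ‖v y‖ₑ ≤ eLpNormEssSup v (volume.restrict Ω))} := fun y hy h => by
    have h1 := h hy.1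
    rw [← eLpNorm_exponent_top] at h1
    exact absurd hy.2 (not_lt.2 h1)
  exact (hopen.measure_pos volume ⟨x, hx, hlt⟩).ne' (measure_mono_null hsub hnull)

theorem normLinf_le (hΩ : IsOpen Ω) {M : ℝ} (hM : ∀ x ∈ Ω, |v x| ≤ M) :
    normLinf Ω v ≤ ENNReal.ofReal M := by
  rw [normLinf, eLpNorm_exponent_top]
  exact eLpNormEssSup_le_of_ae_bound ((ae_restrict_iff' hΩ.measurableSet).2
    (Eventually.of_forall hM))

end Norm

/-! ### The maximum norm of the error as a scalar subsolution -/

section MaxNorm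

variable {d : ℕ} {Ω : Set (EuclideanSpace ℝ (Fin d))} {α lam T : ℝ}
  {a b : Fin d → EuclideanSpace ℝ (Fin d) → ℝ} {c : EuclideanSpace ℝ (Fin d) → ℝ}
  {e : EuclideanSpace ℝ (Fin d) → ℝ → ℝ}

/-- The Caputo derivative of a function that is Lipschitz in time uniformly in space is continuous in
space. -/
theorem continuousOn_caputo (hα : α < 1) (hΩb : Bornology.IsBounded Ω)
    (he : ContinuousOn (fun p : EuclideanSpace ℝ (Fin d) × ℝ => e p.1 p.2) (closure Ω ×ˢ Icc 0 T))
    (heL : ∀ ε > 0, ∃ K : ℝ≥0, ∀ x ∈ Ω, LipschitzOnWith K (e x) (Icc ε T))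
    {t : ℝ} (ht : t ∈ Ioc 0 T) : ContinuousOn (fun x => caputo α (e x) t) Ω := by
  obtain ⟨M, hM⟩ := (hΩb.isCompact_closure.prod isCompact_Icc).exists_bound_of_continuousOn he
  obtain ⟨K, hK⟩ := heL (t / 2) (by linarith [ht.1])
  have hcx : ∀ s ∈ Icc 0 T, ContinuousOn (fun x => e x s) Ω := fun s hs =>
    he.comp (f := fun x => (x, s)) (by fun_prop) fun x hx => ⟨subset_closure hx, hs⟩
  have hct : ∀ x ∈ Ω, ContinuousOn (e x) (Icc 0 T) := fun x hx =>
    he.comp (f := fun s => (x, s)) (by fun_prop) fun s hs => ⟨subset_closure hx, hs⟩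
  have hsub : ∀ s ∈ Ioo 0 t, s ∈ Icc 0 T := fun s hs => ⟨hs.1.le, hs.2.le.trans ht.2⟩
  have htT : t ∈ Icc 0 T := ⟨ht.1.le, ht.2⟩
  have h0T : (0 : ℝ) ∈ Icc 0 T := ⟨le_rfl, ht.1.le.trans ht.2⟩
  refine continuousOn_const.mul ((continuousOn_const.mul ((hcx t htT).sub (hcx 0 h0T))).add
    (continuousOn_const.mul ?_))
  -- K and M do not depend on x, so one multiple of (t-s)^(-α) dominates all the integrands.
  refine continuousOn_of_dominated
    (bound := fun s => (K + 2 * M / (t - t / 2)) * (t - s) ^ (-α)) (fun x hx => ?_)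
    (fun x hx => ?_) ((integrableOn_sub_rpow_neg hα t).const_mul _) ?_
  · exact (continuousOn_caputoIntegrand α ((hct x hx).mono hsub)).aestronglyMeasurable
      measurableSet_Ioo
  · have h := abs_sub_le_of_lipschitzOn (t := t) (v := e x) (M := M) (half_lt_self ht.1)
      (fun s hs => hM (x, s) ⟨subset_closure hx, hs.1, hs.2.trans ht.2⟩)
      ((hK x hx).mono (Icc_subset_Icc_right ht.2))
    exact (ae_restrict_iff' measurableSet_Ioo).2 (Eventually.of_forall fun s hs =>
      abs_caputoIntegrand_le hs.2 (h s ⟨hs.1.le, hs.2.le⟩))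
  · exact (ae_restrict_iff' measurableSet_Ioo).2 (Eventually.of_forall fun s hs =>
      continuousOn_const.mul ((hcx t htT).sub (hcx s (hsub s hs))))

/-- The maximum norm of a function that vanishes on the boundary and initially is a subsolution of
the scalar problem whose right-hand side is the norm of `(D_t^α + 𝓛) e`. -/
theorem exists_maxNorm_subsolution (hα : α ∈ Ioo (0 : ℝ) 1) (hΩ : IsOpen Ω)
    (hΩb : Bornology.IsBounded Ω) (hne : Ω.Nonempty)
    (ha : ∀ k, ContinuousOn (a k) Ω) (hb : ∀ k, ContinuousOn (b k) Ω) (hc : ContinuousOn c Ω)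
    (ha_pos : ∀ k, ∀ x ∈ Ω, 0 < a k x) (hc_lam : ∀ x ∈ Ω, lam ≤ c x)
    (he : ContinuousOn (fun p : EuclideanSpace ℝ (Fin d) × ℝ => e p.1 p.2) (closure Ω ×ˢ Icc 0 T))
    (heL : ∀ ε > 0, ∃ K : ℝ≥0, ∀ x ∈ Ω, LipschitzOnWith K (e x) (Icc ε T))
    (heC : ∀ t ∈ Ioc 0 T, ContDiffOn ℝ 2 (fun x => e x t) Ω)
    (he0 : ∀ x ∈ Ω, e x 0 = 0) (heb : ∀ x ∈ frontier Ω, ∀ t ∈ Ioc 0 T, e x t = 0) (hT : 0 < T) :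
    ∃ m : ℝ → ℝ, ContinuousOn m (Icc 0 T) ∧ m 0 = 0 ∧
      (∀ ε > 0, ∃ K : ℝ≥0, LipschitzOnWith K m (Icc ε T)) ∧
      (∀ t ∈ Icc 0 T, ∀ x ∈ Ω, |e x t| ≤ m t) ∧
      ∀ t ∈ Ioc 0 T, ENNReal.ofReal (caputo α m t + lam * m t) ≤
        normLinf Ω fun x => caputo α (e x) t + spatialOp a b c (fun y => e y t) x := by
  have hcx : ∀ s ∈ Icc 0 T, ContinuousOn (fun x => e x s) (closure Ω) := fun s hs =>
    he.comp (f := fun x => (x, s)) (by fun_prop) fun x hx => ⟨hx, hs⟩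
  have hct : ∀ x ∈ Ω, ContinuousOn (e x) (Icc 0 T) := fun x hx =>
    he.comp (f := fun s => (x, s)) (by fun_prop) fun s hs => ⟨subset_closure hx, hs⟩
  have hcomp : IsCompact (closure Ω) := hΩb.isCompact_closure
  have hmax : ∀ t ∈ Icc 0 T, ∃ r : ℝ, (∀ x ∈ closure Ω, |e x t| ≤ r) ∧
      ∃ x ∈ closure Ω, |e x t| = r := fun t ht => by
    obtain ⟨x, hx, hxm⟩ := hcomp.exists_isMaxOn hne.closure (hcx t ht).abs
    exact ⟨|e x t|, fun y hy => hxm hy, x, hx, rfl⟩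
  choose! m hm_le hm_att using hmax
  have hsub : ∀ s ∈ Icc 0 T, ∀ t ∈ Icc 0 T, ∀ C, (∀ x ∈ closure Ω, |e x t - e x s| ≤ C) →
      m t ≤ m s + C := fun s hs t ht C hC => by
    obtain ⟨x, hx, hxt⟩ := hm_att t ht
    have h1 := hm_le s hs x hx
    have h2 := hC x hx
    have h3 := abs_sub_abs_le_abs_sub (e x t) (e x s)
    linarith
  have habs : ∀ s ∈ Icc 0 T, ∀ t ∈ Icc 0 T, ∀ C, (∀ x ∈ closure Ω, |e x t - e x s| ≤ C) →
      |m t - m s| ≤ C := fun s hs t ht C hC => by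
    have h1 := hsub s hs t ht C hC
    have h2 := hsub t ht s hs C fun x hx => by rw [abs_sub_comm]; exact hC x hx
    rw [abs_le]
    constructor <;> linarith
  have h0T : (0 : ℝ) ∈ Icc 0 T := ⟨le_rfl, hT.le⟩
  -- The boundary condition excludes time 0; continuity carries the initial values to the closure.
  have he0' : ∀ x ∈ closure Ω, e x 0 = 0 := fun x hx => by
    have h1 : Tendsto (fun y => e y 0) (𝓝[Ω] x) (𝓝 (e x 0)) :=
      (hcx 0 h0T x hx).mono_left (nhdsWithin_mono x subset_closure)
    have : (𝓝[Ω] x).NeBot := mem_closure_iff_nhdsWithin_neBot.1 hx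
    exact tendsto_nhds_unique h1 (tendsto_const_nhds.congr'
      (eventually_mem_nhdsWithin.mono fun y hy => (he0 y hy).symm))
  have hfront : ∀ x ∈ closure Ω, x ∉ Ω → ∀ t ∈ Ioc 0 T, e x t = 0 := fun x hx hxn t ht =>
    heb x (by rw [hΩ.frontier_eq]; exact ⟨hx, hxn⟩) t ht
  have hmc : ContinuousOn m (Icc 0 T) := by
    have huc := (hcomp.prod isCompact_Icc).uniformContinuousOn_of_continuous he
    rw [Metric.uniformContinuousOn_iff_le] at huc
    rw [Metric.continuousOn_iff]
    intro t ht ε hε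
    obtain ⟨δ, hδ, hδe⟩ := huc (ε / 2) (by linarith)
    refine ⟨δ, hδ, fun s hs hst => ?_⟩
    rw [Real.dist_eq]
    refine (habs t ht s hs (ε / 2) fun x hx => ?_).trans_lt (by linarith)
    exact hδe (x, s) ⟨hx, hs⟩ (x, t) ⟨hx, ht⟩ (by rw [dist_prod_same_left]; exact hst.le)
  have hmL : ∀ ε > 0, ∃ K : ℝ≥0, LipschitzOnWith K m (Icc ε T) := fun ε hε => by
    obtain ⟨K, hK⟩ := heL ε hε
    have hmem : ∀ s ∈ Icc ε T, s ∈ Ioc 0 T := fun s hs => ⟨hε.trans_le hs.1, hs.2⟩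
    refine ⟨K, LipschitzOnWith.of_dist_le_mul fun t ht s hs => ?_⟩
    rw [Real.dist_eq]
    refine habs s (Ioc_subset_Icc_self (hmem s hs)) t (Ioc_subset_Icc_self (hmem t ht)) _
      fun x hx => ?_
    by_cases hxΩ : x ∈ Ω
    · exact (hK x hxΩ).dist_le_mul t ht s hs
    · rw [hfront x hx hxΩ t (hmem t ht), hfront x hx hxΩ s (hmem s hs), sub_self, abs_zero]
      positivity
  refine ⟨m, hmc, ?_, hmL, fun t ht x hx => hm_le t ht x (subset_closure hx), fun t ht => ?_⟩
  · obtain ⟨x, hx, hx0⟩ := hm_att 0 h0T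
    rw [← hx0, he0' x hx, abs_zero]
  have htT : t ∈ Icc 0 T := ⟨ht.1.le, ht.2⟩
  have hmC := hasCaputo_of_locally_lipschitz hα.2 hmc hmL ht
  obtain ⟨x, hx, hxt⟩ := hm_att t htT
  have hmn : ∀ s ∈ Icc 0 T, 0 ≤ m s := fun s hs => (abs_nonneg _).trans (hm_le s hs x hx)
  -- If m t = 0, the maximum point may lie on the boundary, but then m ≥ 0 makes all increments
  -- nonpositive.
  rcases eq_or_lt_of_le (hmn t htT) with hz | hpos
  · have hzero : HasCaputo α (fun _ => (0 : ℝ)) t :=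
      hasCaputo_of_abs_sub_le (C := 0) hα.2 continuousOn_const (by simp)
    have h1 := caputo_le_caputo hα ht.1 hmC hzero fun s hs => by
      rw [← hz, zero_sub, sub_zero, neg_nonpos]
      exact hmn s ⟨hs.1, hs.2.le.trans ht.2⟩
    have h2 : caputo α (fun _ => (0 : ℝ)) t = 0 := by simp [caputo, caputoIntegrand]
    rw [← hz, mul_zero, add_zero, ENNReal.ofReal_of_nonpos (h1.trans h2.le)]
    exact zero_le
  have hxΩ : x ∈ Ω := by
    by_contra hxn
    rw [hfront x hx hxn t ht, abs_zero] at hxt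
    exact hpos.ne hxt
  -- The sign makes σ e touch `m` from below at (x, t), which serves both the time and the space
  -- estimate.
  obtain ⟨σ, hσ, hσe⟩ : ∃ σ : ℝ, |σ| = 1 ∧ σ * e x t = m t := by
    rcases abs_choice (e x t) with h | h
    · exact ⟨1, abs_one, by rw [one_mul, ← h, hxt]⟩
    · exact ⟨-1, by rw [abs_neg, abs_one], by rw [neg_one_mul, ← h, hxt]⟩
  have hσle : ∀ y s, σ * e y s ≤ |e y s| := fun y s =>
    (le_abs_self _).trans (by rw [abs_mul, hσ, one_mul])
  have hexL : ∀ ε > 0, ∃ K : ℝ≥0, LipschitzOnWith K (e x) (Icc ε T) := fun ε hε =>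
    (heL ε hε).imp fun K hK => hK x hxΩ
  have hexC := hasCaputo_of_locally_lipschitz hα.2 (hct x hxΩ) hexL ht
  have h1 : caputo α m t ≤ σ * caputo α (e x) t := by
    rw [← caputo_const_mul]
    refine caputo_le_caputo hα ht.1 hmC (hexC.const_mul σ) fun s hs => ?_
    rw [hσe]
    have := (hσle x s).trans (hm_le s ⟨hs.1, hs.2.le.trans ht.2⟩ x hx)
    linarith
  have h2 : lam * m t ≤ σ * spatialOp a b c (fun y => e y t) x := by
    rw [← spatialOp_const_mul]
    have hcont : ContinuousAt (fun y => σ * e y t) x :=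
      continuousAt_const.mul ((heC t ht).continuousOn.continuousAt (hΩ.mem_nhds hxΩ))
    have hlm : IsLocalMax (fun y => σ * e y t) x := by
      filter_upwards [hΩ.mem_nhds hxΩ] with y hy
      rw [hσe]
      exact (hσle y t).trans (hm_le t htT y (subset_closure hy))
    refine le_trans ?_ (le_spatialOp_of_isLocalMax (fun k => ha_pos k x hxΩ) hcont hlm)
    rw [hσe]
    exact mul_le_mul_of_nonneg_right (hc_lam x hxΩ) hpos.le
  -- Continuity in space is what lets the `L_∞` norm bound the value at the particular point x.
  have hR : ContinuousOn (fun x => caputo α (e x) t + spatialOp a b c (fun y => e y t) x) Ω :=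
    (continuousOn_caputo hα.2 hΩb he heL ht).add
      (continuousOn_spatialOp hΩ ha hb hc (heC t ht))
  refine le_trans ?_ (enorm_le_normLinf hΩ hR hxΩ)
  rw [← ofReal_norm, Real.norm_eq_abs]
  refine ENNReal.ofReal_le_ofReal ?_
  calc caputo α m t + lam * m t
      ≤ σ * (caputo α (e x) t + spatialOp a b c (fun y => e y t) x) := by linarith
    _ ≤ |σ * (caputo α (e x) t + spatialOp a b c (fun y => e y t) x)| := le_abs_self _
    _ = _ := by rw [abs_mul, hσ, one_mul]

end MaxNorm

end TimeFrac

end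

/-! ### Assembly of the error bounds -/

open Set MeasureTheory TimeFrac in
theorem theorem2 {d : ℕ} (Ω : Set (EuclideanSpace ℝ (Fin d))) (hΩ : IsOpen Ω)
    (hΩb : Bornology.IsBounded Ω) (T α lam : ℝ) (hT : 0 < T) (hα : α ∈ Ioo (0 : ℝ) 1)
    (a b : Fin d → EuclideanSpace ℝ (Fin d) → ℝ) (c : EuclideanSpace ℝ (Fin d) → ℝ)
    (ha : ∀ k, ContinuousOn (a k) (closure Ω)) (hb : ∀ k, ContinuousOn (b k) (closure Ω))
    (hc : ContinuousOn c (closure Ω)) (ha_pos : ∀ k, ∀ x ∈ closure Ω, 0 < a k x)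
    (hlam : 0 ≤ lam) (hc_lam : ∀ x ∈ closure Ω, lam ≤ c x)
    (f : EuclideanSpace ℝ (Fin d) → ℝ → ℝ) (u₀ : EuclideanSpace ℝ (Fin d) → ℝ)
    (u uh : EuclideanSpace ℝ (Fin d) → ℝ → ℝ)
    (hu : Regular Ω T u) (huh : Regular Ω T uh)
    (hu_data : HasData Ω T u₀ u) (huh_data : HasData Ω T u₀ uh)
    (hu_eq : ∀ x ∈ Ω, ∀ t ∈ Ioc 0 T,
      caputo α (u x) t + spatialOp a b c (fun y => u y t) x = f x t) :
    -- the bound of the error by the inverse operator applied to the norm of the residual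
    (∀ t ∈ Ioc 0 T,
      normLinf Ω (fun x => uh x t - u x t) ≤
        invCaputoAdd α lam (fun s => normLinf Ω (fun x => residual α a b c f uh x s)) t) ∧
    -- the bound by a general barrier function
    (∀ E : ℝ → ℝ, ContinuousOn E (Ioc 0 T) → (∀ t ∈ Icc 0 T, 0 ≤ E t) →
      (∀ t ∈ Ioc 0 T, HasCaputo α E t) →
      (∀ t ∈ Ioc 0 T,
        ((normLinf Ω (fun x => residual α a b c f uh x t) : ENNReal) : EReal) ≤
          ((caputo α E t + lam * E t : ℝ) : EReal)) →
      ∀ t ∈ Icc 0 T, normLinf Ω (fun x => uh x t - u x t) ≤ ENNReal.ofReal (E t)) ∧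
    -- the bound with the residual barrier `𝓡₀`
    (∀ t ∈ Ioc 0 T,
      normLinf Ω (fun x => uh x t - u x t) ≤
        ⨆ s ∈ Ioc 0 t, normLinf Ω (fun x => residual α a b c f uh x s) /
          ENNReal.ofReal (barrierR₀ α lam s)) ∧
    -- the bounds with the residual barrier `𝓡₁`, with either factor in front of the supremum
    (∀ τ : ℝ, 0 < τ → ∀ t ∈ Ioc 0 T,
      normLinf Ω (fun x => uh x t - u x t) ≤
        ENNReal.ofReal (t ^ (α - 1)) *
          ⨆ s ∈ Ioc 0 t, normLinf Ω (fun x => residual α a b c f uh x s) /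
            ENNReal.ofReal (barrierR₁ α lam τ s)) ∧
    (∀ τ : ℝ, 0 < τ → ∀ t ∈ Ioc 0 T,
      normLinf Ω (fun x => uh x t - u x t) ≤
        ENNReal.ofReal (barrierE₁ α τ t) *
          ⨆ s ∈ Ioc 0 t, normLinf Ω (fun x => residual α a b c f uh x s) /
            ENNReal.ofReal (barrierR₁ α lam τ s)) ∧
    -- the lower bound on `ρ` in the definition of `𝓡₁`
    (∀ s : ℝ, 0 < s → s ^ (-(1 - α)) * min ((1 - α) * s) 1 ≤ rho α s) := by
  set e : EuclideanSpace ℝ (Fin d) → ℝ → ℝ := fun x t => uh x t - u x t with he_def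
  -- On the empty set no maximum exists, but all norms are 0.
  rcases Ω.eq_empty_or_nonempty with rfl | hne
  · have hz : ∀ v : EuclideanSpace ℝ (Fin d) → ℝ, normLinf ∅ v = 0 := fun v => by simp [normLinf]
    refine ⟨fun _ _ => ?_, fun _ _ _ _ _ _ _ => ?_, fun _ _ => ?_, fun _ _ _ _ => ?_,
      fun _ _ _ _ => ?_, fun s hs => le_rho hα hs⟩ <;> rw [hz] <;> exact zero_le
  have heL : ∀ ε > 0, ∃ K : ℝ≥0, ∀ x ∈ Ω, LipschitzOnWith K (e x) (Icc ε T) := fun ε hε => by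
    obtain ⟨K₁, h₁⟩ := huh.exists_lipschitzOnWith hΩ hΩb hε
    obtain ⟨K₂, h₂⟩ := hu.exists_lipschitzOnWith hΩ hΩb hε
    exact ⟨K₁ + K₂, fun x hx => (h₁ x hx).sub (h₂ x hx)⟩
  obtain ⟨m, hmc, hm0, hmL, hme, hmR⟩ := exists_maxNorm_subsolution (a := a) (b := b) (c := c)
    (lam := lam) (e := e) hα hΩ hΩb hne (fun k => (ha k).mono subset_closure)
    (fun k => (hb k).mono subset_closure) (hc.mono subset_closure)
    (fun k x hx => ha_pos k x (subset_closure hx)) (fun x hx => hc_lam x (subset_closure hx))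
    (huh.continuousOn.sub hu.continuousOn) heL
    (fun t ht => (huh.contDiffOn t ht).sub (hu.contDiffOn t ht))
    (fun x hx => by rw [he_def]; simp only [huh_data.initial x hx, hu_data.initial x hx, sub_self])
    (fun x hx t ht => by
      rw [he_def]; simp only [huh_data.boundary x hx t ht, hu_data.boundary x hx t ht, sub_self])
    hT
  have hC : ∀ {v}, Regular Ω T v → ∀ x ∈ Ω, ∀ t ∈ Ioc 0 T, HasCaputo α (v x) t :=
    fun hv x hx t ht => hasCaputo_of_locally_lipschitz hα.2
      (hv.continuousOn.comp (f := fun s => (x, s)) (by fun_prop)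
        fun s hs => ⟨subset_closure hx, hs⟩)
      (fun ε hε => (hv.exists_lipschitzOnWith hΩ hΩb hε).imp fun K hK => hK x hx) ht
  -- The equation for `u` eliminates `f`, so the residual is continuous in space without any
  -- regularity of `f`.
  have hres : ∀ t ∈ Ioc 0 T, ∀ x ∈ Ω, residual α a b c f uh x t =
      caputo α (e x) t + spatialOp a b c (fun y => e y t) x := fun t ht x hx => by
    rw [TimeFrac.residual, ← hu_eq x hx t ht, he_def, caputo_sub (hC huh x hx t ht) (hC hu x hx t ht),
      spatialOp_sub hΩ (huh.contDiffOn t ht) (hu.contDiffOn t ht) hx]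
    ring
  have hsub : ∀ t ∈ Ioc 0 T, ENNReal.ofReal (caputo α m t + lam * m t) ≤
      normLinf Ω fun x => residual α a b c f uh x t := fun t ht =>
    (hmR t ht).trans_eq (eLpNorm_congr_ae ((ae_restrict_iff' hΩ.measurableSet).2
      (Filter.Eventually.of_forall fun x hx => (hres t ht x hx).symm)))
  have hnorm : ∀ t ∈ Icc 0 T, normLinf Ω (fun x => uh x t - u x t) ≤ ENNReal.ofReal (m t) :=
    fun t ht => normLinf_le hΩ (hme t ht)
  have hE₁ := fun τ (hτ : 0 < τ) t (ht : t ∈ Ioc 0 T) =>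
    (hnorm t (Ioc_subset_Icc_self ht)).trans
      (ofReal_le_barrierE₁_mul_iSup_div hα hlam hmc hm0 hmL hsub hτ t ht)
  refine ⟨fun t ht => (hnorm t (Ioc_subset_Icc_self ht)).trans
      (ofReal_le_invCaputoAdd hα hlam hmc hm0 hmL hsub t ht), fun E hE hE0 hEC hER t ht => ?_,
    fun t ht => (hnorm t (Ioc_subset_Icc_self ht)).trans
      (ofReal_le_iSup_div_barrierR₀ hα hlam hmc hm0 hmL hsub t ht), fun τ hτ t ht => ?_, hE₁,
    fun s hs => le_rho hα hs⟩
  · refine (hnorm t ht).trans (ENNReal.ofReal_le_ofReal (le_of_caputo_add_le hα hlam hmc hm0 hmL hE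
      hE0 hEC (fun s hs => ?_) t ht))
    have h1 := (EReal.coe_ennreal_le_coe_ennreal_iff.2 (hsub s hs)).trans (hER s hs)
    -- In `EReal` the left side is the maximum of the real number and 0; only the first entry is
    -- needed.
    rw [EReal.coe_ennreal_ofReal, EReal.coe_le_coe_iff] at h1
    exact (le_max_left _ _).trans h1
  · refine (hE₁ τ hτ t ht).trans ?_
    gcongr
    exact Real.rpow_le_rpow_of_nonpos ht.1 (le_max_right _ _) (by linarith [hα.2])
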